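/- Let $\mathbb K$ be a normed division algebra: a nonzero finite-dimensional real unital algebra, possibly nonassociative, with a conjugation $*$ such that $a^{**}=a$, $(ab)^*=b^*a^*$, with $\mathrm{Re}(a)=\frac12(a+a^*)\in\mathbb R$, and such that $|a|=\sqrt{aa^*}$ is a positive definite multiplicative norm. (Examples are $\mathbb R,\mathbb C,\mathbb H,\mathbb O$.) For a hermitian $2\times2$ matrix $A$ over $\mathbb K$ put $\tilde A=A-(\mathrm{tr}A)1$, and let $\mathcal V$ be the space of $4\times 4$ matrices $\mathcal A=\begin{pmatrix}a&\tilde A\\A&-a\end{pmatrix}$ with $a\in\mathbb R$ and $A$ hermitian, with the Minkowski metric $h(\mathcal A,\mathcal A)=a^2-\det A$. Let $\mathcal S=\mathbb K^4$, on which $\mathcal V$ acts by left multiplication (the Clifford action), with the pairing $\langle\Psi,\Phi\rangle=\mathrm{Re}(\Psi^\dagger\Gamma^0\Phi)$, $\Gamma^0=\begin{pmatrix}0&-1\\1&0\end{pmatrix}$. Let $\Psi\cdot\Phi\in\mathcal V$ be the vector with $h(\Psi\cdot\Phi,\mathcal A)=\langle\Psi,\mathcal A\Phi\rangle$ for all $\mathcal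 A\in\mathcal V$. The supertranslation algebra $\mathcal T=\mathcal V\oplus\mathcal S$ is the Lie superalgebra with even part $\mathcal V$, odd part $\mathcal S$, whose only nonzero bracket is $[\Psi,\Phi]=\Psi\cdot\Phi$ on spinors. An $L_\infty$-superalgebra consists of super vector spaces $V_0,V_1,V_2,\dots$ and parity-preserving multilinear maps $l_k$ ($k\ge1$) of degree $k-2$ on their direct sum, graded-antisymmetric (with signs given by degree plus parity) and satisfying the generalized Jacobi identities; it is a Lie $n$-superalgebra if $V_p=0$ for $p\ge n$. If only $V_0$ and $V_n$ are nonzero and $d=l_1=0$, it corresponds to the quadruple $(\mathfrak g,R,\rho,l_{n+2})$, where $\mathfrak g=V_0$ is a Lie superalgebra with bracket $l_2$, $R=V_n$, $\rho(x)f=l_2(x,f)$ is a representation, and $l_{n+2}$ is an even $(n+2)$-cocycle on $\mathfrak g$ with values in $R$. A Lie $n$-superalgebra is exact if only $V_0$ and $V_{n-1}$ are nonzero, $d=0$, and the cocycle $l_{n+1}$ is a Chevalley--Eilenberg coboundary. Then $\dim\mathcal V=\dim\mathbb K+3$; in particular $\dim\mathcal V=4,5,7,11$ for $\mathbb K=\mathbb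 R,\mathbb C,\mathbb H,\mathbb O$. There is a unique $(2,2)$-form $\beta$ on $\mathcal T$ (a real-valued super-skew-symmetric $4$-linear map that, on homogeneous arguments, vanishes unless two are vectors and two are spinors) with $$\beta(\Psi,\Phi,\mathcal A,\mathcal B)=\langle\Psi,(\mathcal A\mathcal B-\mathcal B\mathcal A)\Phi\rangle,$$ the commutator being taken in the Clifford algebra of $\mathcal V$; it is an even $4$-cocycle with values in the trivial representation $\mathbb R$. There exists a non-exact Lie $3$-superalgebra, concentrated in degrees $0$ and $2$ with $d=0$, that corresponds to the quadruple $(\mathcal T,\mathbb R,\text{trivial representation},\beta)$. It is an extension of $\mathcal T$: there is a short exact sequence of $L_\infty$-superalgebras $0\to \mathrm b^2\mathbb R\to L\to\mathcal T\to0$, where $\mathrm b^2\mathbb R$ is $\mathbb R$ in degree $2$ with all operations zero. -/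

import Mathlib

open scoped Quaternion Matrix DirectSum

set_option linter.unusedSectionVars false

/-! ## Normed division algebras -/

/-- A normed division algebra: a nonzero finite-dimensional real unital algebra, not assumed
associative or commutative, with a conjugation `star` (`a** = a`, `(ab)* = b* a*`), real part
`Re a = (a + a*) / 2 ∈ ℝ 1`, and norm `|a| = √(a a*)` that is positive definite and multiplicative
(both stated for the square `a a* ∈ ℝ 1` of the norm). -/
class NormedDivisionAlgebra (K : Type*) [NonAssocRing K] [StarRing K] [Module ℝ K]
    [IsScalarTower ℝ K K] [SMulCommClass ℝ K K] [StarModule ℝ K] where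
  nontrivial : Nontrivial K
  finite : Module.Finite ℝ K
  /-- The real part. -/
  re : K →ₗ[ℝ] ℝ
  re_smul_one : ∀ a : K, re a • (1 : K) = (2⁻¹ : ℝ) • (a + star a)
  normSq_pos : ∀ a : K, a ≠ 0 → 0 < re (a * star a)
  normSq_mul : ∀ a b : K,
    re ((a * b) * star (a * b)) = re (a * star a) * re (b * star b)

instance : NormedDivisionAlgebra ℝ where
  nontrivial := inferInstance
  finite := inferInstance
  re := LinearMap.id
  re_smul_one a := by
    simp only [star_trivial, LinearMap.id_apply, smul_eq_mul]
    ring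
  normSq_pos a ha := by simpa using ha
  normSq_mul a b := by
    simp only [star_trivial, LinearMap.id_apply]
    ring

noncomputable instance : NormedDivisionAlgebra ℂ where
  nontrivial := inferInstance
  finite := inferInstance
  re := Complex.reLm
  re_smul_one a := by
    apply Complex.ext
    · simp; ring
    · simp
  normSq_pos a ha := by
    have h := Complex.normSq_pos.2 ha
    rw [Complex.normSq_apply] at h
    simpa using h
  normSq_mul a b := by
    simp
    ring

instance : StarModule ℝ ℍ[ℝ] where
  star_smul r a := by ext <;> simp

/-- The real part of a quaternion. -/
def Quaternion.reLinear : ℍ[ℝ] →ₗ[ℝ] ℝ where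
  toFun a := a.re
  map_add' _ _ := rfl
  map_smul' _ _ := rfl

theorem Quaternion.reLinear_apply (a : ℍ[ℝ]) : Quaternion.reLinear a = a.re := rfl

noncomputable instance : NormedDivisionAlgebra ℍ[ℝ] where
  nontrivial := inferInstance
  finite := inferInstance
  re := Quaternion.reLinear
  re_smul_one a := by
    ext <;> simp [Quaternion.reLinear_apply]
    ring
  normSq_pos a ha := by
    have h : 0 < Quaternion.normSq a :=
      lt_of_le_of_ne Quaternion.normSq_nonneg (Ne.symm (Quaternion.normSq_ne_zero.2 ha))
    simpa [Quaternion.normSq_def, Quaternion.reLinear_apply] using h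
  normSq_mul a b := by
    simp [Quaternion.reLinear_apply]
    ring

/-- The octonions, as pairs of quaternions (Cayley–Dickson construction). -/
def Octonion : Type := ℍ[ℝ] × ℍ[ℝ]

namespace Octonion

instance : AddCommGroup Octonion := inferInstanceAs (AddCommGroup (ℍ[ℝ] × ℍ[ℝ]))
instance : Module ℝ Octonion := inferInstanceAs (Module ℝ (ℍ[ℝ] × ℍ[ℝ]))
instance : Module.Finite ℝ Octonion := inferInstanceAs (Module.Finite ℝ (ℍ[ℝ] × ℍ[ℝ]))
instance : Nontrivial Octonion := inferInstanceAs (Nontrivial (ℍ[ℝ] × ℍ[ℝ]))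

@[ext] theorem ext {x y : Octonion} (h₁ : x.1 = y.1) (h₂ : x.2 = y.2) : x = y := Prod.ext h₁ h₂

noncomputable instance : One Octonion := ⟨((1 : ℍ[ℝ]), (0 : ℍ[ℝ]))⟩

/-- `(a, b) (c, d) = (a c - d* b, d a + b c*)`. -/
noncomputable instance : Mul Octonion :=
  ⟨fun x y => (x.1 * y.1 - star y.2 * x.2, y.2 * x.1 + x.2 * star y.1)⟩

/-- `(a, b)* = (a*, -b)`. -/
instance : Star Octonion := ⟨fun x => (star x.1, -x.2)⟩

@[simp] theorem one_fst : (1 : Octonion).1 = 1 := rfl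
@[simp] theorem one_snd : (1 : Octonion).2 = 0 := rfl
@[simp] theorem zero_fst : (0 : Octonion).1 = 0 := rfl
@[simp] theorem zero_snd : (0 : Octonion).2 = 0 := rfl
@[simp] theorem add_fst (x y : Octonion) : (x + y).1 = x.1 + y.1 := rfl
@[simp] theorem add_snd (x y : Octonion) : (x + y).2 = x.2 + y.2 := rfl
@[simp] theorem smul_fst (r : ℝ) (x : Octonion) : (r • x).1 = r • x.1 := rfl
@[simp] theorem smul_snd (r : ℝ) (x : Octonion) : (r • x).2 = r • x.2 := rfl
@[simp] theorem mul_fst (x y : Octonion) : (x * y).1 = x.1 * y.1 - star y.2 * x.2 := rfl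
@[simp] theorem mul_snd (x y : Octonion) : (x * y).2 = y.2 * x.1 + x.2 * star y.1 := rfl
@[simp] theorem star_fst (x : Octonion) : (star x).1 = star x.1 := rfl
@[simp] theorem star_snd (x : Octonion) : (star x).2 = -x.2 := rfl

noncomputable instance : NonAssocRing Octonion :=
  { (inferInstance : AddCommGroup Octonion), (inferInstance : Mul Octonion),
    (inferInstance : One Octonion) with
    left_distrib := fun a b c => by
      ext1
      · simp only [mul_fst, add_fst, add_snd, star_add, mul_add, add_mul]; abel
      · simp only [mul_snd, add_fst, add_snd, star_add, mul_add, add_mul]; abel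
    right_distrib := fun a b c => by
      ext1
      · simp only [mul_fst, add_fst, add_snd, mul_add, add_mul]; abel
      · simp only [mul_snd, add_fst, add_snd, mul_add, add_mul]; abel
    zero_mul := fun a => by ext1 <;> simp
    mul_zero := fun a => by ext1 <;> simp
    one_mul := fun a => by ext1 <;> simp
    mul_one := fun a => by ext1 <;> simp }

noncomputable instance : StarRing Octonion where
  star_involutive a := by ext1 <;> simp
  star_mul a b := by
    ext1
    · simp
    · simp only [star_snd, mul_snd, star_fst, star_star]
      rw [neg_mul, neg_mul, neg_add, add_comm]
  star_add a b := by
    ext1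
    · simp
    · simp only [star_snd, add_snd]; abel

instance : IsScalarTower ℝ Octonion Octonion where
  smul_assoc r x y := by
    ext1
    · simp [smul_sub]
    · simp [smul_add]

instance : SMulCommClass ℝ Octonion Octonion where
  smul_comm r x y := by
    ext1
    · simp [smul_sub]
    · simp [smul_add]

instance : StarModule ℝ Octonion where
  star_smul r x := by ext1 <;> simp

/-- The real part of an octonion. -/
def reLinear : Octonion →ₗ[ℝ] ℝ where
  toFun x := x.1.re
  map_add' _ _ := rfl
  map_smul' _ _ := rfl

theorem reLinear_apply (x : Octonion) : reLinear x = x.1.re := rfl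

theorem reLinear_mul_star (x : Octonion) :
    reLinear (x * star x) = Quaternion.normSq x.1 + Quaternion.normSq x.2 := by
  simp [reLinear_apply, Quaternion.normSq_def']
  ring

noncomputable instance : NormedDivisionAlgebra Octonion where
  nontrivial := inferInstance
  finite := inferInstance
  re := reLinear
  re_smul_one x := by
    apply Octonion.ext
    · ext <;> simp [reLinear_apply]
      ring
    · simp
  normSq_pos x hx := by
    rw [reLinear_mul_star]
    by_contra h
    have h1 := Quaternion.normSq_nonneg (a := x.1)
    have h2 := Quaternion.normSq_nonneg (a := x.2)
    apply hx
    apply Octonion.ext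
    · exact Quaternion.normSq_eq_zero.1 (by linarith)
    · exact Quaternion.normSq_eq_zero.1 (by linarith)
  normSq_mul x y := by
    rw [reLinear_mul_star, reLinear_mul_star, reLinear_mul_star]
    simp [Quaternion.normSq_def']
    ring

end Octonion

/-! ## Vectors and spinors in `dim K + 3` dimensions -/

section Spacetime

variable (K : Type*) [NonAssocRing K] [StarRing K] [Module ℝ K] [IsScalarTower ℝ K K]
  [SMulCommClass ℝ K K] [StarModule ℝ K]

/-- The hermitian `2 × 2` matrices over `K`. -/
abbrev Herm : Type _ := selfAdjoint.submodule ℝ (Matrix (Fin 2) (Fin 2) K)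

/-- Vectors in `dim K + 3` dimensions; `(a, A)` stands for the `4 × 4` matrix with blocks
`a, Ã` and `A, -a` (see `Vec.toMatrix`). -/
abbrev Vec : Type _ := ℝ × Herm K

/-- Spinors in `dim K + 3` dimensions: `K⁴ = K² ⊕ K²`. -/
abbrev Spinor : Type _ := Fin 2 ⊕ Fin 2 → K

variable {K}

/-- Trace reversal `Ã = A - (tr A) 1`. -/
def traceReversal (A : Matrix (Fin 2) (Fin 2) K) : Matrix (Fin 2) (Fin 2) K :=
  A - Matrix.diagonal fun _ => A.trace

theorem traceReversal_mem {A : Matrix (Fin 2) (Fin 2) K}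
    (hA : A ∈ selfAdjoint.submodule ℝ (Matrix (Fin 2) (Fin 2) K)) :
    traceReversal A ∈ selfAdjoint.submodule ℝ (Matrix (Fin 2) (Fin 2) K) := by
  have h : star A = A := hA
  have h' : star A.trace = A.trace := by
    conv_rhs => rw [← h]
    simp [Matrix.trace, Matrix.star_apply]
  change star (traceReversal A) = traceReversal A
  simp only [traceReversal, star_sub, h]
  rw [Matrix.star_eq_conjTranspose, Matrix.diagonal_conjTranspose]
  congr 2
  funext i
  simp [h']

/-- The `4 × 4` matrix of a vector. -/
def Vec.toMatrix (v : Vec K) : Matrix (Fin 2 ⊕ Fin 2) (Fin 2 ⊕ Fin 2) K :=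
  Matrix.fromBlocks (v.1 • 1) (traceReversal v.2.1) v.2.1 (-(v.1 • 1))

/-- The Clifford action of vectors on spinors, `Γ(v) Ψ = v Ψ`. -/
def cliffordAction (v : Vec K) : Module.End ℝ (Spinor K) where
  toFun Ψ := v.toMatrix *ᵥ Ψ
  map_add' Ψ Φ := Matrix.mulVec_add _ Ψ Φ
  map_smul' r Ψ := by
    simp [Matrix.mulVec_smul]

variable [NormedDivisionAlgebra K]

open NormedDivisionAlgebra (re)

/-- `-det A`, that is `-t² + x² + |y|²` for the hermitian matrix with rows `t + x, y` and
`y*, t - x`. -/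
def minkowskiSq (A : Herm K) : ℝ :=
  re (A.1 0 1 * star (A.1 0 1)) - re (A.1 0 0) * re (A.1 1 1)

/-- The Minkowski metric `g` on hermitian matrices, the polarization of `-det`. -/
noncomputable def metric₂ (A B : Herm K) : ℝ :=
  (minkowskiSq (A + B) - minkowskiSq A - minkowskiSq B) / 2

/-- The Minkowski metric `h` on vectors, with `h((a, A), (a, A)) = g(A, A) + a²`. -/
noncomputable def metric (v w : Vec K) : ℝ := metric₂ v.2 w.2 + v.1 * w.1

/-- The matrix `Γ⁰`. -/
def gammaZero : Matrix (Fin 2 ⊕ Fin 2) (Fin 2 ⊕ Fin 2) K := Matrix.fromBlocks 0 (-1) 1 0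

/-- The pairing of spinors `⟨Ψ, Φ⟩ = Re (Ψ† Γ⁰ Φ)`. -/
def spinorPairing (Ψ Φ : Spinor K) : ℝ := re (star Ψ ⬝ᵥ (gammaZero *ᵥ Φ))

/-- `ψ φ† + φ ψ†` for `ψ, φ ∈ K²`. -/
def hermOuter (ψ φ : Fin 2 → K) : Herm K :=
  ⟨Matrix.vecMulVec ψ (star φ) + Matrix.vecMulVec φ (star ψ), by
    change star _ = _
    ext i j
    simp [Matrix.star_apply, Matrix.vecMulVec_apply, add_comm]⟩

/-- The bracket of spinors `Ψ · Φ`; its characterization is `metric_spinorDot`. -/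
def spinorDot (Ψ Φ : Spinor K) : Vec K :=
  (re (star (Ψ ∘ Sum.inl) ⬝ᵥ (Φ ∘ Sum.inr)) + re (star (Φ ∘ Sum.inl) ⬝ᵥ (Ψ ∘ Sum.inr)),
    -⟨traceReversal (hermOuter (Ψ ∘ Sum.inl) (Φ ∘ Sum.inl)).1, traceReversal_mem (hermOuter _ _).2⟩
      + hermOuter (Ψ ∘ Sum.inr) (Φ ∘ Sum.inr))

/-! ### The metric is nondegenerate and characterizes the bracket of spinors -/

theorem re_eq_of_smul_one {r s : ℝ} (h : r • (1 : K) = s • (1 : K)) : r = s := by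
  have := NormedDivisionAlgebra.nontrivial (K := K)
  exact smul_left_injective ℝ (one_ne_zero (α := K)) h

theorem re_star (a : K) : re (star a) = re a := by
  apply re_eq_of_smul_one (K := K)
  rw [NormedDivisionAlgebra.re_smul_one, NormedDivisionAlgebra.re_smul_one, star_star, add_comm]

theorem re_one : re (1 : K) = 1 := by
  apply re_eq_of_smul_one (K := K)
  rw [NormedDivisionAlgebra.re_smul_one, star_one, ← two_smul ℝ (1 : K), smul_smul]
  norm_num

theorem smul_one_of_star_eq {a : K} (h : star a = a) : re a • (1 : K) = a := by
  rw [NormedDivisionAlgebra.re_smul_one, h, ← two_smul ℝ a, smul_smul]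
  norm_num

theorem star_eq_sub (a : K) : star a = (2 * re a) • (1 : K) - a := by
  rw [mul_smul, NormedDivisionAlgebra.re_smul_one, smul_smul]
  norm_num

theorem re_mul_star_comm (a b : K) : re (a * star b) = re (b * star a) := by
  rw [← re_star, star_mul, star_star]

theorem re_mul_mul_star (a b c : K) :
    re ((a * b) * star (a * c)) = re (a * star a) * re (b * star c) := by
  have h := NormedDivisionAlgebra.normSq_mul a (b + c)
  have h1 := NormedDivisionAlgebra.normSq_mul a b
  have h2 := NormedDivisionAlgebra.normSq_mul a c
  have h3 := re_mul_star_comm (a * b) (a * c)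
  have h4 := re_mul_star_comm b c
  simp only [mul_add, add_mul, star_add, map_add] at h h1 h2 h3 h4 ⊢
  linear_combination (h - h1 - h2 + h3 - re (a * star a) * h4) / 2

theorem re_mul_star_left (a b c : K) :
    re ((a * b) * star c) = re (b * star (star a * c)) := by
  have h := re_mul_mul_star (a + 1) b c
  have h1 := re_mul_mul_star a b c
  simp only [add_mul, one_mul, star_add, mul_add, map_add, star_one, mul_one, re_one,
    re_star] at h
  rw [star_eq_sub a, sub_mul, smul_mul_assoc, one_mul, star_sub, star_smul, mul_sub,
    mul_smul_comm, map_sub, map_smul]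
  simp only [star_trivial, smul_eq_mul]
  linear_combination h - h1

theorem re_star_mul (x y : K) : re (star x * y) = re (x * star y) := by
  have h := re_star y
  rw [star_eq_sub x, star_eq_sub y]
  simp only [sub_mul, mul_sub, smul_mul_assoc, mul_smul_comm, one_mul, mul_one, map_sub,
    map_smul, smul_eq_mul]
  ring

theorem re_mul_star_right (a b c : K) :
    re ((a * b) * star c) = re (a * star (c * star b)) := by
  have h := re_mul_star_left (star b) (star a) (star c)
  rw [star_star, star_star, star_mul, star_star, re_star_mul] at h
  rw [← re_star_mul, star_mul, h]

theorem metric₂_eq (A B : Herm K) :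
    metric₂ A B = re (A.1 0 1 * star (B.1 0 1))
      - (re (A.1 0 0) * re (B.1 1 1) + re (B.1 0 0) * re (A.1 1 1)) / 2 := by
  have h := re_mul_star_comm (A.1 0 1) (B.1 0 1)
  simp only [metric₂, minkowskiSq, Submodule.coe_add, Matrix.add_apply, star_add, mul_add,
    add_mul, map_add]
  linear_combination -h / 2

theorem Herm.star_apply (A : Herm K) (i j : Fin 2) : star (A.1 i j) = A.1 j i :=
  congrFun (congrFun (show star A.1 = A.1 from A.2) j) i

theorem metric_spinorDot (Ψ Φ : Spinor K) (v : Vec K) :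
    metric (spinorDot Ψ Φ) v = spinorPairing Ψ (cliffordAction v Φ) := by
  obtain ⟨a, A⟩ := v
  have h00 : A.1 0 0 = re (A.1 0 0) • (1 : K) := (smul_one_of_star_eq (Herm.star_apply A 0 0)).symm
  have h11 : A.1 1 1 = re (A.1 1 1) • (1 : K) := (smul_one_of_star_eq (Herm.star_apply A 1 1)).symm
  have h10 : A.1 1 0 = star (A.1 0 1) := (Herm.star_apply A 0 1).symm
  have f (x y z : K) : re (x * (star y * star z)) = re ((x * star y) * star z) := by
    rw [re_mul_star_right, star_star, star_mul]
  have e (x y z : K) : re (x * (star y * z)) = re ((y * star x) * star z) := by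
    rw [re_mul_star_right y (star x) z, star_star]
    have h1 := re_mul_star_left (star z) y x
    rw [star_star, re_mul_star_comm, star_mul, star_star] at h1
    exact h1
  rw [metric, metric₂_eq]
  simp only [spinorDot, spinorPairing, cliffordAction, Vec.toMatrix, gammaZero]
  simp [Matrix.mulVec, dotProduct, traceReversal, hermOuter, Matrix.vecMulVec_apply, Matrix.trace,
    Matrix.one_apply, re_star_mul]
  rw [h00, h11, h10]
  simp only [mul_add, add_mul, neg_mul, mul_neg, map_add, map_neg, map_smul, smul_eq_mul, re_one,
    star_one, mul_one, star_star, mul_smul_comm, star_smul, star_trivial, f, e]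
  have c1 := re_mul_star_comm (Ψ (Sum.inl 0)) (Φ (Sum.inl 0))
  have c2 := re_mul_star_comm (Ψ (Sum.inl 1)) (Φ (Sum.inl 1))
  have c3 := re_mul_star_comm (Ψ (Sum.inr 0)) (Φ (Sum.inr 0))
  have c4 := re_mul_star_comm (Ψ (Sum.inr 1)) (Φ (Sum.inr 1))
  have c5 := re_mul_star_comm (Ψ (Sum.inr 0)) (Φ (Sum.inl 0))
  have c6 := re_mul_star_comm (Ψ (Sum.inr 1)) (Φ (Sum.inl 1))
  linear_combination (re (A.1 0 0) / 2) * (c1 + c4) + (re (A.1 1 1) / 2) * (c2 + c3)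
    - a * (c5 + c6)

theorem eq_of_metric_eq {v w : Vec K} (h : ∀ u, metric v u = metric w u) : v = w := by
  have hM (p q : ℝ) (y : K) : !![p • 1, y; star y, q • 1] ∈
      selfAdjoint.submodule ℝ (Matrix (Fin 2) (Fin 2) K) := by
    change star _ = _
    ext i j
    fin_cases i <;> fin_cases j <;> simp [Matrix.star_apply]
  have h1 := h (1, 0)
  have h2 (p q : ℝ) (y : K) := h (0, ⟨_, hM p q y⟩)
  simp only [metric, metric₂_eq] at h1 h2
  simp [re_one] at h1 h2
  have hp := h2 1 0 0
  have hq := h2 0 1 0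
  have hy := h2 0 0 (v.2.1 0 1 - w.2.1 0 1)
  simp at hp hq hy
  have e01 : v.2.1 0 1 = w.2.1 0 1 := by
    by_contra hne
    have := NormedDivisionAlgebra.normSq_pos _ (sub_ne_zero.2 hne)
    rw [sub_mul, map_sub] at this
    rw [star_sub] at this
    linarith
  have r (A : Herm K) (i : Fin 2) : A.1 i i = re (A.1 i i) • (1 : K) :=
    (smul_one_of_star_eq (Herm.star_apply A i i)).symm
  refine Prod.ext h1 (Subtype.ext ?_)
  ext i j
  fin_cases i <;> fin_cases j
  · change v.2.1 0 0 = w.2.1 0 0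
    rw [r v.2 0, r w.2 0, hq]
  · exact e01
  · change v.2.1 1 0 = w.2.1 1 0
    rw [← Herm.star_apply v.2 0 1, ← Herm.star_apply w.2 0 1, e01]
  · change v.2.1 1 1 = w.2.1 1 1
    rw [r v.2 1, r w.2 1, hp]

end Spacetime

/-! ## Lie superalgebras and their cohomology -/

/-- A super vector space: a real vector space that is the direct sum of an even and an odd part. -/
class SuperSpace (W : Type*) [AddCommGroup W] [Module ℝ W] where
  even : Submodule ℝ W
  odd : Submodule ℝ W
  isCompl : IsCompl even odd

/-- The homogeneous elements of parity `p`. -/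
def SuperSpace.part (W : Type*) [AddCommGroup W] [Module ℝ W] [SuperSpace W] (p : ZMod 2) :
    Submodule ℝ W :=
  if p = 0 then SuperSpace.even else SuperSpace.odd

/-- The real line, purely even. -/
instance : SuperSpace ℝ := ⟨⊤, ⊥, isCompl_top_bot⟩

/-- The sign `(-1)^p`. -/
def paritySign (p : ZMod 2) : ℝ := if p = 0 then 1 else -1

/-- The Koszul sign `ε(σ; x₁, …, xₙ)` for elements `xᵢ` of grade `d i`, given by
`x₁ ⋯ xₙ = ε(σ) x_σ(1) ⋯ x_σ(n)` in the free graded-commutative algebra. -/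
def koszulSign {n : ℕ} (σ : Equiv.Perm (Fin n)) (d : Fin n → ZMod 2) : ℝ :=
  ∏ a, ∏ b, if a < b ∧ σ b < σ a then paritySign (d (σ a) * d (σ b)) else 1

/-- `χ(σ) = sgn(σ) ε(σ)`. -/
def chi {n : ℕ} (σ : Equiv.Perm (Fin n)) (d : Fin n → ZMod 2) : ℝ :=
  ((Equiv.Perm.sign σ : ℤ) : ℝ) * koszulSign σ d

/-- A Lie superalgebra over `ℝ`. -/
class LieSuperalgebra (g : Type*) [AddCommGroup g] [Module ℝ g] extends SuperSpace g where
  bracket : g →ₗ[ℝ] g →ₗ[ℝ] g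
  bracket_mem : ∀ (p q : ZMod 2) (x y : g), x ∈ SuperSpace.part g p → y ∈ SuperSpace.part g q →
    bracket x y ∈ SuperSpace.part g (p + q)
  bracket_skew : ∀ (p q : ZMod 2) (x y : g), x ∈ SuperSpace.part g p → y ∈ SuperSpace.part g q →
    bracket x y = -(paritySign (p * q) • bracket y x)
  jacobi : ∀ (p q : ZMod 2) (x y z : g), x ∈ SuperSpace.part g p → y ∈ SuperSpace.part g q →
    bracket x (bracket y z) =
      bracket (bracket x y) z + paritySign (p * q) • bracket y (bracket x z)

/-- A representation of a Lie superalgebra `g` on a super vector space `R`. -/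
structure SuperRepresentation (g R : Type*) [AddCommGroup g] [Module ℝ g] [LieSuperalgebra g]
    [AddCommGroup R] [Module ℝ R] [SuperSpace R] where
  map : g →ₗ[ℝ] R →ₗ[ℝ] R
  map_mem : ∀ (p q : ZMod 2) (x : g) (r : R), x ∈ SuperSpace.part g p →
    r ∈ SuperSpace.part R q → map x r ∈ SuperSpace.part R (p + q)
  map_bracket : ∀ (p q : ZMod 2) (x y : g) (r : R), x ∈ SuperSpace.part g p →
    y ∈ SuperSpace.part g q →
    map (LieSuperalgebra.bracket x y) r = map x (map y r) - paritySign (p * q) • map y (map x r)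

/-- The trivial representation. -/
def SuperRepresentation.trivial (g R : Type*) [AddCommGroup g] [Module ℝ g] [LieSuperalgebra g]
    [AddCommGroup R] [Module ℝ R] [SuperSpace R] : SuperRepresentation g R where
  map := 0
  map_mem _ _ _ _ _ _ := Submodule.zero_mem _
  map_bracket _ _ _ _ _ _ _ := by simp

section Cochains

variable {g R : Type*} [AddCommGroup g] [Module ℝ g] [SuperSpace g]
  [AddCommGroup R] [Module ℝ R] [SuperSpace R]

/-- `ω` is an `n`-cochain (a super-skew-symmetric `n`-linear map) of parity `s`; it is even if
`s = 0` and odd if `s = 1`. -/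
structure IsCochain {n : ℕ} (ω : MultilinearMap ℝ (fun _ : Fin n => g) R) (s : ZMod 2) :
    Prop where
  skew : ∀ (σ : Equiv.Perm (Fin n)) (x : Fin n → g) (p : Fin n → ZMod 2),
    (∀ i, x i ∈ SuperSpace.part g (p i)) → ω (fun i => x (σ i)) = chi σ p • ω x
  parity : ∀ (x : Fin n → g) (p : Fin n → ZMod 2),
    (∀ i, x i ∈ SuperSpace.part g (p i)) → ω x ∈ SuperSpace.part R (s + ∑ i, p i)

/-- The value at homogeneous elements `x i` of parity `p i` of the coboundary `dω` of an
`(n + 1)`-cochain `ω` of parity `s`, for a bracket `br` and an action `ρ`. Indices start at `0`.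
In the second sum `x i` and `x j`, `i < j`, are removed from the arguments and their bracket is
put in front. -/
def coboundary (br : g → g → g) (ρ : g → R → R) {n : ℕ}
    (ω : MultilinearMap ℝ (fun _ : Fin (n + 1) => g) R) (s : ZMod 2)
    (x : Fin (n + 2) → g) (p : Fin (n + 2) → ZMod 2) : R :=
  (∑ i : Fin (n + 2),
    ((-1 : ℝ) ^ (i : ℕ) * paritySign (p i * s) * paritySign (p i * ∑ a with a < i, p a)) •
      ρ (x i) (ω fun t => x (i.succAbove t))) +
  ∑ i : Fin (n + 1), ∑ j : Fin (n + 2), if i.castSucc < j then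
    ((-1 : ℝ) ^ ((i : ℕ) + (j : ℕ)) * paritySign (p i.castSucc * p j) *
        paritySign (p i.castSucc * ∑ a with a < i.castSucc, p a) *
        paritySign (p j * ∑ a with a < j, p a)) •
      ω (Fin.cons (br (x i.castSucc) (x j)) fun t => x (j.succAbove (i.succAbove t)))
  else 0

/-- The cochain `ω` of parity `s` is a cocycle: `dω = 0`. -/
def IsCocycle (br : g → g → g) (ρ : g → R → R) {n : ℕ}
    (ω : MultilinearMap ℝ (fun _ : Fin (n + 1) => g) R) (s : ZMod 2) : Prop :=
  IsCochain ω s ∧ ∀ (x : Fin (n + 2) → g) (p : Fin (n + 2) → ZMod 2),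
    (∀ i, x i ∈ SuperSpace.part g (p i)) → coboundary br ρ ω s x p = 0

/-- `ω` is trivial (exact): `ω = dθ` for some cochain `θ`, written as the sum of its even part
`θ₀` and its odd part `θ₁`. -/
def IsTrivialCocycle (br : g → g → g) (ρ : g → R → R) {n : ℕ}
    (ω : MultilinearMap ℝ (fun _ : Fin (n + 2) => g) R) : Prop :=
  ∃ θ₀ θ₁ : MultilinearMap ℝ (fun _ : Fin (n + 1) => g) R, IsCochain θ₀ 0 ∧ IsCochain θ₁ 1 ∧
    ∀ (x : Fin (n + 2) → g) (p : Fin (n + 2) → ZMod 2),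
      (∀ i, x i ∈ SuperSpace.part g (p i)) →
      ω x = coboundary br ρ θ₀ 0 x p + coboundary br ρ θ₁ 1 x p

end Cochains

/-! ## The supertranslation algebra and the `(2, 2)`-form -/

section Supertranslation

variable (K : Type*) [NonAssocRing K] [StarRing K] [Module ℝ K] [IsScalarTower ℝ K K]
  [SMulCommClass ℝ K K] [StarModule ℝ K] [NormedDivisionAlgebra K]

/-- The supertranslation algebra: vectors are even, spinors are odd. -/
abbrev Supertranslation : Type _ := Vec K × Spinor K

variable {K}

theorem spinorDot_comm (Ψ Φ : Spinor K) : spinorDot Ψ Φ = spinorDot Φ Ψ := by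
  have h (ψ φ : Fin 2 → K) : hermOuter ψ φ = hermOuter φ ψ := Subtype.ext (add_comm _ _)
  simp only [spinorDot, h, add_comm]

theorem metric_add_left (u v w : Vec K) : metric (u + v) w = metric u w + metric v w := by
  simp only [metric, metric₂_eq, Prod.fst_add, Prod.snd_add, Submodule.coe_add, Matrix.add_apply,
    map_add, add_mul]
  ring

theorem metric_smul_left (r : ℝ) (v w : Vec K) : metric (r • v) w = r * metric v w := by
  simp only [metric, metric₂_eq, Prod.smul_fst, Prod.smul_snd, Submodule.coe_smul,
    Matrix.smul_apply, map_smul, smul_mul_assoc, smul_eq_mul]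
  ring

theorem spinorDot_add_right (Ψ Φ Φ' : Spinor K) :
    spinorDot Ψ (Φ + Φ') = spinorDot Ψ Φ + spinorDot Ψ Φ' := by
  apply eq_of_metric_eq
  intro u
  rw [metric_add_left, metric_spinorDot, metric_spinorDot, metric_spinorDot, map_add]
  simp only [spinorPairing, Matrix.mulVec_add, dotProduct_add, map_add]

theorem spinorDot_smul_right (r : ℝ) (Ψ Φ : Spinor K) :
    spinorDot Ψ (r • Φ) = r • spinorDot Ψ Φ := by
  apply eq_of_metric_eq
  intro u
  rw [metric_smul_left, metric_spinorDot, metric_spinorDot, map_smul]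
  simp only [spinorPairing, Matrix.mulVec_smul, dotProduct_smul, map_smul, smul_eq_mul]

/-- The bracket: `[(v, Ψ), (w, Φ)] = (Ψ · Φ, 0)`. -/
def supertranslationBracket :
    Supertranslation K →ₗ[ℝ] Supertranslation K →ₗ[ℝ] Supertranslation K :=
  LinearMap.mk₂ ℝ (fun x y => (spinorDot x.2 y.2, 0))
    (fun x x' y => by
      simp [spinorDot_comm _ y.2, spinorDot_add_right])
    (fun r x y => by
      simp [spinorDot_comm _ y.2, spinorDot_smul_right])
    (fun x y y' => by simp [spinorDot_add_right])
    (fun r x y => by simp [spinorDot_smul_right])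

instance : SuperSpace (Supertranslation K) where
  even := Submodule.prod ⊤ ⊥
  odd := Submodule.prod ⊥ ⊤
  isCompl := by
    constructor
    · rw [Submodule.disjoint_def]
      rintro ⟨v, Ψ⟩ h h'
      simp_all
    · rw [codisjoint_iff, eq_top_iff]
      rintro ⟨v, Ψ⟩ -
      refine Submodule.mem_sup.2 ⟨(v, 0), by simp, (0, Ψ), by simp, by simp⟩

theorem supertranslationBracket_apply (x y : Supertranslation K) :
    supertranslationBracket x y = (spinorDot x.2 y.2, 0) := rfl

theorem spinorDot_zero_right (Ψ : Spinor K) : spinorDot Ψ 0 = 0 := by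
  simpa using spinorDot_smul_right 0 Ψ 0

theorem spinorDot_zero_left (Ψ : Spinor K) : spinorDot 0 Ψ = 0 := by
  rw [spinorDot_comm, spinorDot_zero_right]

theorem mem_part_zero {x : Supertranslation K} :
    x ∈ SuperSpace.part (Supertranslation K) 0 ↔ x.2 = 0 := by
  simp [SuperSpace.part, SuperSpace.even]

theorem mem_part_one {x : Supertranslation K} :
    x ∈ SuperSpace.part (Supertranslation K) 1 ↔ x.1 = 0 := by
  simp [SuperSpace.part, SuperSpace.odd]

noncomputable instance : LieSuperalgebra (Supertranslation K) where
  bracket := supertranslationBracket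
  bracket_mem p q x y hx hy := by
    rw [supertranslationBracket_apply]
    by_cases hp : p = 0
    · rw [hp] at hx
      rw [mem_part_zero.1 hx, spinorDot_zero_left]
      exact Submodule.zero_mem _
    by_cases hq : q = 0
    · rw [hq] at hy
      rw [mem_part_zero.1 hy, spinorDot_zero_right]
      exact Submodule.zero_mem _
    have h : p + q = 0 :=
      (by decide : ∀ p q : ZMod 2, p ≠ 0 → q ≠ 0 → p + q = 0) p q hp hq
    rw [h, mem_part_zero]
  bracket_skew p q x y hx hy := by
    rw [supertranslationBracket_apply, supertranslationBracket_apply]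
    by_cases hp : p = 0
    · rw [hp] at hx
      rw [mem_part_zero.1 hx, spinorDot_zero_left, spinorDot_zero_right]
      simp
    by_cases hq : q = 0
    · rw [hq] at hy
      rw [mem_part_zero.1 hy, spinorDot_zero_left, spinorDot_zero_right]
      simp
    have h : p * q ≠ 0 :=
      (by decide : ∀ p q : ZMod 2, p ≠ 0 → q ≠ 0 → p * q ≠ 0) p q hp hq
    rw [paritySign, if_neg h, spinorDot_comm]
    simp
  jacobi p q x y z _ _ := by
    simp [supertranslationBracket_apply, spinorDot_zero_left, spinorDot_zero_right]

/-- `β` is the `(2, 2)`-form (a cochain that vanishes on homogeneous arguments unless exactly two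
of them are vectors and two are spinors) with `β(Ψ, Φ, v, w) = ⟨Ψ, (v w - w v) Φ⟩`, the
commutator being taken in the Clifford algebra. -/
structure IsMembraneForm (β : MultilinearMap ℝ (fun _ : Fin 4 => Supertranslation K) ℝ) :
    Prop where
  isCochain : IsCochain β 0
  eq_zero : ∀ (x : Fin 4 → Supertranslation K) (p : Fin 4 → ZMod 2),
    (∀ i, x i ∈ SuperSpace.part (Supertranslation K) (p i)) →
    Finset.card {i | p i = 1} ≠ 2 → β x = 0
  apply : ∀ (Ψ Φ : Spinor K) (v w : Vec K),
    β ![(0, Ψ), (0, Φ), (v, 0), (w, 0)] =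
      spinorPairing Ψ (⁅cliffordAction v, cliffordAction w⁆ Φ)

end Supertranslation

/-! ## `L∞`-superalgebras -/

/-- An `L∞`-superalgebra: super vector spaces `V 0, V 1, V 2, …` and multilinear maps `l k`,
`k ≥ 1`, on their direct sum, of degree `k - 2`, preserving parity, graded-antisymmetric and
satisfying the generalized Jacobi identity. The sign conventions use the overall grade, the sum
of degree and parity. The value `l 0` is a placeholder. -/
structure LInftySuperalgebra.{u} where
  V : ℕ → Type u
  [addCommGroup : ∀ q, AddCommGroup (V q)]
  [module : ∀ q, Module ℝ (V q)]
  [superSpace : ∀ q, SuperSpace (V q)]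
  l : ∀ k : ℕ, MultilinearMap ℝ (fun _ : Fin k => ⨁ q, V q) (⨁ q, V q)
  l_zero : l 0 = 0
  degree : ∀ (k : ℕ) (q : Fin k → ℕ) (x : ∀ i, V (q i)) (r : ℕ), r + 2 ≠ (∑ i, q i) + k →
    l k (fun i => DirectSum.of V (q i) (x i)) r = 0
  parity : ∀ (k : ℕ) (q : Fin k → ℕ) (p : Fin k → ZMod 2) (x : ∀ i, V (q i)),
    (∀ i, x i ∈ SuperSpace.part (V (q i)) (p i)) →
    ∀ r, l k (fun i => DirectSum.of V (q i) (x i)) r ∈ SuperSpace.part (V r) (∑ i, p i)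
  antisymm : ∀ (k : ℕ) (q : Fin k → ℕ) (p : Fin k → ZMod 2) (x : ∀ i, V (q i)),
    (∀ i, x i ∈ SuperSpace.part (V (q i)) (p i)) → ∀ σ : Equiv.Perm (Fin k),
    l k (fun i => DirectSum.of V (q (σ i)) (x (σ i))) =
      chi σ (fun i => (q i : ZMod 2) + p i) • l k (fun i => DirectSum.of V (q i) (x i))
  /-- The outer sum is over the number `i + 1` of arguments of the inner operation; `σ` runs over
  the unshuffles, increasing on the first `i + 1` and on the last `n - (i + 1)` positions. -/
  jacobi : ∀ (n : ℕ) (q : Fin n → ℕ) (p : Fin n → ZMod 2) (x : ∀ i, V (q i)),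
    (∀ i, x i ∈ SuperSpace.part (V (q i)) (p i)) →
    ∑ i : Fin n, ∑ σ : Equiv.Perm (Fin n) with
        (∀ a b : Fin n, a < b → (b : ℕ) < i + 1 → σ a < σ b) ∧
        (∀ a b : Fin n, a < b → (i : ℕ) + 1 ≤ a → σ a < σ b),
      (chi σ (fun a => (q a : ZMod 2) + p a) * (-1 : ℝ) ^ (((i : ℕ) + 1) * (n - (i + 1)))) •
        l (n - i) (fun t =>
          if (t : ℕ) = 0 then
            l (i + 1) (fun s =>
              DirectSum.of V (q (σ ⟨s, by omega⟩)) (x (σ ⟨s, by omega⟩)))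
          else
            DirectSum.of V (q (σ ⟨i + t, by omega⟩)) (x (σ ⟨i + t, by omega⟩))) = 0

namespace LInftySuperalgebra

attribute [instance] addCommGroup module superSpace

/-- A Lie `n`-superalgebra: all nonzero terms have degree `< n`. -/
def IsLieSuperalgebra (L : LInftySuperalgebra) (n : ℕ) : Prop := ∀ q, n ≤ q → Subsingleton (L.V q)

/-- Only `V 0` and `V n` are nonzero, and `d = l 1` vanishes. -/
def IsTwoTerm (L : LInftySuperalgebra) (n : ℕ) : Prop :=
  (∀ q, q ≠ 0 → q ≠ n → Subsingleton (L.V q)) ∧ L.l 1 = 0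

/-- The bracket `[x, y]` on `V 0`. -/
def bracket (L : LInftySuperalgebra) (x y : L.V 0) : L.V 0 :=
  L.l 2 ![DirectSum.of L.V 0 x, DirectSum.of L.V 0 y] 0

/-- The action `[x, f]` of `V 0` on `V n`. -/
def action (L : LInftySuperalgebra) (n : ℕ) (x : L.V 0) (f : L.V n) : L.V n :=
  L.l 2 ![DirectSum.of L.V 0 x, DirectSum.of L.V n f] n

/-- The `(n + 2)`-cochain on `V 0` with values in `V n` that is given by `l (n + 2)`. -/
def topCochain (L : LInftySuperalgebra) (n : ℕ) :
    MultilinearMap ℝ (fun _ : Fin (n + 2) => L.V 0) (L.V n) :=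
  (DirectSum.component ℝ ℕ L.V n).compMultilinearMap
    ((L.l (n + 2)).compLinearMap fun _ => DirectSum.lof ℝ ℕ L.V 0)

/-- The Lie `(n + 1)`-superalgebra `L` is exact: only `V 0` and `V n` are nonzero, with `d = 0`,
and the `(n + 2)`-cocycle `l (n + 2)` on `V 0` with values in `V n` is trivial. -/
def IsExact (L : LInftySuperalgebra) (n : ℕ) : Prop :=
  L.IsLieSuperalgebra (n + 1) ∧ L.IsTwoTerm n ∧
    IsTrivialCocycle L.bracket (L.action n) (L.topCochain n)

/-- A parity-preserving linear isomorphism. -/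
def _root_.LinearEquiv.IsSuper {W W' : Type*} [AddCommGroup W] [Module ℝ W] [SuperSpace W]
    [AddCommGroup W'] [Module ℝ W'] [SuperSpace W'] (e : W ≃ₗ[ℝ] W') : Prop :=
  ∀ (p : ZMod 2) (x : W), x ∈ SuperSpace.part W p ↔ e x ∈ SuperSpace.part W' p

section Correspondence

variable {g R : Type*} [AddCommGroup g] [Module ℝ g] [LieSuperalgebra g]
  [AddCommGroup R] [Module ℝ R] [SuperSpace R]

/-- `L` consists of two terms `V 0` and `V n`, has `d = 0`, and corresponds to the quadruple
`(g, R, ρ, ω)`: up to parity-preserving isomorphisms, `V 0` with its bracket is `g`, `V n` is `R`,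
the action `[x, f]` is `ρ`, and `l (n + 2)` is `ω`. -/
def CorrespondsTo (L : LInftySuperalgebra) (n : ℕ) (ρ : SuperRepresentation g R)
    (ω : MultilinearMap ℝ (fun _ : Fin (n + 2) => g) R) : Prop :=
  L.IsTwoTerm n ∧ ∃ (e₀ : g ≃ₗ[ℝ] L.V 0) (e₁ : R ≃ₗ[ℝ] L.V n), e₀.IsSuper ∧ e₁.IsSuper ∧
    (∀ x y, L.bracket (e₀ x) (e₀ y) = e₀ (LieSuperalgebra.bracket x y)) ∧
    (∀ x r, L.action n (e₀ x) (e₁ r) = e₁ (ρ.map x r)) ∧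
    ∀ x : Fin (n + 2) → g, L.topCochain n (fun i => e₀ (x i)) = e₁ (ω x)

variable (g R)

/-- `L` is the Lie superalgebra `g`, regarded as an `L∞`-superalgebra in degree `0`. -/
def IsOfLie (L : LInftySuperalgebra) : Prop :=
  (∀ q, q ≠ 0 → Subsingleton (L.V q)) ∧ ∃ e : g ≃ₗ[ℝ] L.V 0, e.IsSuper ∧
    ∀ x y, L.bracket (e x) (e y) = e (LieSuperalgebra.bracket x y)

/-- `L` is `bⁿR`: the super vector space `R` in degree `n`, with all operations zero. -/
def IsShift (L : LInftySuperalgebra) (n : ℕ) : Prop :=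
  (∀ q, q ≠ n → Subsingleton (L.V q)) ∧ (∀ k, L.l k = 0) ∧ ∃ e : R ≃ₗ[ℝ] L.V n, e.IsSuper

end Correspondence

/-- A (strict) homomorphism of `L∞`-superalgebras. -/
structure Hom (L M : LInftySuperalgebra) where
  map : ∀ q, L.V q →ₗ[ℝ] M.V q
  map_mem : ∀ (q : ℕ) (p : ZMod 2) (x : L.V q), x ∈ SuperSpace.part (L.V q) p →
    map q x ∈ SuperSpace.part (M.V q) p
  map_l : ∀ (k : ℕ) (x : Fin k → ⨁ q, L.V q),
    DirectSum.lmap map (L.l k x) = M.l k (fun i => DirectSum.lmap map (x i))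

/-- `L` is an extension of the Lie superalgebra `g` by `bⁿR`: there is a short exact sequence
`0 → bⁿR → L → g → 0` of `L∞`-superalgebras. -/
def IsExtension.{u, v, w} (L : LInftySuperalgebra.{u}) (n : ℕ) (g : Type v) (R : Type w)
    [AddCommGroup g] [Module ℝ g] [LieSuperalgebra g] [AddCommGroup R] [Module ℝ R] [SuperSpace R] : Prop :=
  ∃ (A B : LInftySuperalgebra.{u}) (ι : Hom A L) (π : Hom L B), A.IsShift R n ∧ B.IsOfLie g ∧
    ∀ q, Function.Injective (ι.map q) ∧ Function.Exact (ι.map q) (π.map q) ∧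
      Function.Surjective (π.map q)

end LInftySuperalgebra

/-! Everything rests on one quartic spinor identity: `⟨(Ψ·Ψ)Ψ, vΨ⟩ = 0` for every spinor `Ψ` and
every vector `v` (`spinorPairing_cliffordAction_spinorDot_self`). Write `Ψ = (ψ, φ)` with `ψ, φ ∈
K²`. Associativity is not available, but the composition property of the norm is enough. The law `(a
b*) b = |b|² a` removes the terms of `(Ψ·Ψ)Ψ` that are cubic in `ψ` alone or in `φ` alone. The
adjunction rules for the real part and the polarized norm identity `re_mul_mul_star_add` turn the
remaining quartic expressions into terms that cancel.

Since `⟨Ψ, vΦ⟩` is symmetric in the spinors while the pairing is antisymmetric, `⟨Ψ, [v, w]Φ⟩` is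
symmetric in the spinors and antisymmetric in the vectors. It therefore extends, with Koszul signs,
to a super-skew form `β`, and uniquely, because homogeneous arguments can be sorted. Only spinors
have nonzero brackets, and these are vectors, so `dβ` can be nonzero only on four spinors and one
vector. There it is, up to sign, the full polarization of `⟨Ψ, [Ψ·Ψ, v]Ψ⟩ = 0`, a sum of six terms
(`membraneForm_spinorDot_sum`).

The Lie 3-superalgebra has `l 2` equal to the bracket, `l 4 = β` and no other operations. In a
generalized Jacobi identity the inner operation must be `l 2`, because `l 4` lands in degree 2,
where every operation vanishes. With three arguments the identity follows from two-step nilpotency,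
with five it is `dβ = 0` (`bracketCochainOp_jacobi`).

For non-exactness, every term of a coboundary with trivial coefficients contains a bracket of two
arguments, so coboundaries vanish on arguments that commute pairwise. Two spinors with `Ψ·Φ = 0` and
two vectors on which `β` is nonzero give the contradiction. -/

set_option linter.unusedSimpArgs false

/-! ## Identities in normed division algebras -/

section Algebra

variable {K : Type*} [NonAssocRing K] [StarRing K] [Module ℝ K] [IsScalarTower ℝ K K]
  [SMulCommClass ℝ K K] [StarModule ℝ K] [NormedDivisionAlgebra K]

open NormedDivisionAlgebra (re)

theorem mul_star_self_eq_smul_one (a : K) : a * star a = re (a * star a) • (1 : K) :=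
  (smul_one_of_star_eq (by rw [star_mul, star_star])).symm

theorem eq_of_re_mul_star_eq {a b : K} (h : ∀ c, re (a * star c) = re (b * star c)) : a = b := by
  by_contra hne
  have h1 := NormedDivisionAlgebra.normSq_pos _ (sub_ne_zero.2 hne)
  rw [sub_mul, map_sub, h, sub_self] at h1
  exact lt_irrefl _ h1

/-- Conjugation reverses products and preserves the real part, so it carries the rule for a common
left factor to one for a common right factor. -/
theorem re_mul_mul_star_same_right (a b c : K) :
    re ((b * a) * star (c * a)) = re (a * star a) * re (b * star c) := by
  have h := re_mul_mul_star (star a) (star b) (star c)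
  rw [← star_mul b a, ← star_mul c a] at h
  simpa only [re_star_mul, star_star] using h

/-- Right multiplication by `b` is adjoint to right multiplication by `b*` and scales the inner
product by `|b|²`; nondegeneracy of the inner product gives the identity. It replaces associativity
in what follows. -/
theorem mul_star_mul_cancel (a b : K) : (a * star b) * b = re (b * star b) • a := by
  apply eq_of_re_mul_star_eq
  intro c
  rw [re_mul_star_right, ← star_star b, star_star (star b), re_mul_mul_star_same_right,
    star_star, re_star_mul, smul_mul_assoc, map_smul, smul_eq_mul]

/-- The polarized multiplicativity of the norm. -/
theorem re_mul_mul_star_add (a b c d : K) :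
    re ((a * b) * star (c * d)) + re ((a * d) * star (c * b)) =
      2 * re (a * star c) * re (b * star d) := by
  have h := re_mul_mul_star (a + c) b d
  have h1 := re_mul_mul_star a b d
  have h2 := re_mul_mul_star c b d
  have h3 := re_mul_star_comm (c * b) (a * d)
  have h4 := re_mul_star_comm c a
  simp only [add_mul, mul_add, star_add, map_add] at h
  linear_combination h - h1 - h2 - h3 + re (b * star d) * h4

/-! ### The quartic spinor identity -/

/-- With `Ψ = (ψ, φ)`, the trace reversals of `ψψ†` and `φφ†` annihilate `ψ` and `φ` respectively,
because `(ψψ†)ψ = |ψ|²ψ` by `mul_star_mul_cancel`. Only the mixed terms remain. -/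
theorem cliffordAction_spinorDot_self (Ψ : Spinor K) :
    cliffordAction (spinorDot Ψ Ψ) Ψ = (2 : ℝ) • Sum.elim
      (fun i => (∑ j, re (Ψ (.inl j) * star (Ψ (.inr j)))) • Ψ (.inl i)
        - ∑ j, (Ψ (.inl i) * star (Ψ (.inl j))) * Ψ (.inr j))
      (fun i => ∑ j, (Ψ (.inr i) * star (Ψ (.inr j))) * Ψ (.inl j)
        - (∑ j, re (Ψ (.inl j) * star (Ψ (.inr j)))) • Ψ (.inr i)) := by
  have h (a : K) : ∃ n : ℝ, a * star a = n • (1 : K) := ⟨_, mul_star_self_eq_smul_one a⟩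
  obtain ⟨n₁, h₁⟩ := h (Ψ (.inl 0))
  obtain ⟨n₂, h₂⟩ := h (Ψ (.inl 1))
  obtain ⟨n₃, h₃⟩ := h (Ψ (.inr 0))
  obtain ⟨n₄, h₄⟩ := h (Ψ (.inr 1))
  ext i
  rcases i with i | i <;> fin_cases i <;>
  · simp [cliffordAction, Vec.toMatrix, spinorDot, Matrix.mulVec, dotProduct, traceReversal,
      hermOuter, Matrix.vecMulVec_apply, Matrix.trace, Matrix.one_apply, re_star_mul, add_mul,
      sub_mul, mul_star_mul_cancel, h₁, h₂, h₃, h₄, re_one]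
    module

theorem spinorPairing_apply (Ψ Φ : Spinor K) :
    spinorPairing Ψ Φ = ∑ i, (re (Ψ (.inr i) * star (Φ (.inl i)))
      - re (Ψ (.inl i) * star (Φ (.inr i)))) := by
  simp [spinorPairing, gammaZero, Matrix.mulVec, dotProduct, Matrix.one_apply, re_star_mul]
  ring

theorem spinorPairing_swap (Ψ Φ : Spinor K) : spinorPairing Ψ Φ = -spinorPairing Φ Ψ := by
  simp only [spinorPairing_apply, re_mul_star_comm (Φ _)]
  simp

/-- Both sides are the metric product of `v` with the commutative bracket `Ψ·Φ`. With the
antisymmetry of the pairing, this makes the Clifford action of a vector skew-adjoint. -/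
theorem spinorPairing_cliffordAction_comm (v : Vec K) (Ψ Φ : Spinor K) :
    spinorPairing Ψ (cliffordAction v Φ) = spinorPairing Φ (cliffordAction v Ψ) := by
  rw [← metric_spinorDot, ← metric_spinorDot, spinorDot_comm]

theorem re_mul_star_mul_mul_star_self (a b c : K) :
    re (a * star b * c * star a) = re (a * star a) * re (c * star b) := by
  rw [re_mul_star_right, re_mul_mul_star, star_star, re_star_mul, re_mul_star_comm b]

/-- The repeated factor `b` makes this reducible: exchanging `c` and `b` by the polarized norm
identity produces `(a b*) b = |b|² a`. -/
theorem re_mul_star_mul_mul_mul (a b c d : K) :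
    re (a * star b * c * (star b * star d)) =
      2 * re (a * (star b * star d)) * re (c * star b)
        - re (b * star b) * re (a * (star c * star d)) := by
  have h := re_mul_mul_star_add (a * star b) c d b
  rw [mul_star_mul_cancel, re_mul_star_right a, star_star, star_mul, star_mul, smul_mul_assoc,
    map_smul, smul_eq_mul] at h
  linear_combination h

/-- Adjunction together with invariance of the real part under conjugation; it brings triple
products to a common form so that they can be compared. -/
theorem re_mul_star_mul_swap (a b c : K) :
    re (a * (star c * b)) = re (c * (star a * star b)) := by
  have h := re_mul_star_left (star b) c a
  rw [star_star, re_mul_star_comm, star_mul, star_star] at h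
  rw [h, star_mul]

/-- The pairing is linear in `v`, so the coefficients of the scalar part `s`, of the diagonal
entries `p`, `q` and of the off-diagonal entry `y` cancel separately. -/
theorem spinorPairing_cliffordAction_spinorDot_self (v : Vec K) (Ψ : Spinor K) :
    spinorPairing (cliffordAction (spinorDot Ψ Ψ) Ψ) (cliffordAction v Ψ) = 0 := by
  obtain ⟨s, A⟩ := v
  have h00 : A.1 0 0 = re (A.1 0 0) • (1 : K) := (smul_one_of_star_eq (Herm.star_apply A 0 0)).symm
  have h11 : A.1 1 1 = re (A.1 1 1) • (1 : K) := (smul_one_of_star_eq (Herm.star_apply A 1 1)).symm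
  have h10 : A.1 1 0 = star (A.1 0 1) := (Herm.star_apply A 0 1).symm
  rw [cliffordAction_spinorDot_self, spinorPairing_apply]
  simp [cliffordAction, Vec.toMatrix, Matrix.mulVec, dotProduct, traceReversal,
      Matrix.trace, Matrix.one_apply]
  rw [h00, h11, h10]
  generalize re (A.1 0 0) = p
  generalize re (A.1 1 1) = q
  generalize A.1 0 1 = y
  generalize Ψ (.inl 0) = a
  generalize Ψ (.inl 1) = b
  generalize Ψ (.inr 0) = c
  generalize Ψ (.inr 1) = d
  have h (a : K) : ∃ n : ℝ, a * star a = n • (1 : K) := ⟨_, mul_star_self_eq_smul_one a⟩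
  obtain ⟨n₁, h₁⟩ := h a
  obtain ⟨n₂, h₂⟩ := h b
  obtain ⟨n₃, h₃⟩ := h c
  obtain ⟨n₄, h₄⟩ := h d
  simp [h₁, h₂, h₃, h₄]
  simp only [mul_add, add_mul, sub_mul, mul_sub, map_add, map_sub, mul_neg, map_neg,
    smul_mul_assoc, mul_smul_comm, map_smul, smul_eq_mul, h₁, h₂, h₃, h₄, re_one,
    re_mul_star_comm _ a]
  have hs (x z : K) := re_mul_star_mul_swap x y z
  -- These reduce the quintic terms containing `y`; `hs` normalizes the triple products that result.
  have e₁ := re_mul_star_mul_mul_mul c d b y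
  have e₂ := re_mul_star_mul_mul_mul d c a (star y)
  have e₃ := re_mul_star_mul_mul_mul a b d y
  have e₄ := re_mul_star_mul_mul_mul b a c (star y)
  simp only [star_star, hs d c, hs d a, hs b a, hs b c, h₁, h₂, h₃, h₄, map_smul, re_one,
    smul_eq_mul] at e₁ e₂ e₃ e₄
  -- These handle the coefficients of `p` and `q`, where the first and last factors agree.
  have g₁ := re_mul_star_mul_mul_star_self c d b
  have g₂ := re_mul_star_mul_mul_star_self d c a
  have g₃ := re_mul_star_mul_mul_star_self a b d
  have g₄ := re_mul_star_mul_mul_star_self b a c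
  simp only [h₁, h₂, h₃, h₄, map_smul, re_one, smul_eq_mul] at g₁ g₂ g₃ g₄
  -- In the coefficient of `s` the four mixed products in `a, b, c, d` have the same real part.
  have k₁ : re (d * star c * a * star b) = re (c * star d * b * star a) := by
    rw [re_mul_star_right, ← re_star_mul, star_mul, star_star,
      re_mul_star_right (c * star d), star_mul, star_star]
  have k₂ : re (b * star a * c * star d) = re (a * star b * d * star c) := by
    rw [re_mul_star_right, ← re_star_mul, star_mul, star_star,
      re_mul_star_right (a * star b), star_mul, star_star]
  have k₃ : re (a * star b * d * star c) = re (c * star d * b * star a) := by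
    rw [re_mul_star_right, re_mul_star_comm, re_mul_star_right (c * star d)]
  rw [re_mul_star_comm a (c * star d * b), re_mul_star_comm a (a * star b * d), g₁, g₂, g₃, g₄,
    k₁, k₂, k₃, e₁, e₂, e₃, e₄, hs b c, hs d c, hs b a, hs d a, re_mul_star_comm c a,
    re_mul_star_comm d b]
  ring

/-! ### Dimension -/

/-- A hermitian matrix is given by its diagonal entries and its upper right entry. -/
def hermEquiv : Herm K ≃ₗ[ℝ] ℝ × ℝ × K where
  toFun A := (re (A.1 0 0), re (A.1 1 1), A.1 0 1)
  map_add' A B := by simp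
  map_smul' r A := by simp
  invFun x := ⟨!![x.1 • 1, x.2.2; star x.2.2, x.2.1 • 1], by
    change star _ = _
    ext i j
    fin_cases i <;> fin_cases j <;> simp [Matrix.star_apply]⟩
  left_inv A := by
    apply Subtype.ext
    ext i j
    fin_cases i <;> fin_cases j <;>
      simp [smul_one_of_star_eq, Herm.star_apply]
  right_inv x := by simp [re_one]

theorem finrank_vec : Module.finrank ℝ (Vec K) = Module.finrank ℝ K + 3 := by
  have := NormedDivisionAlgebra.finite (K := K)
  have : Module.Finite ℝ (Herm K) := Module.Finite.equiv hermEquiv.symm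
  rw [Module.finrank_prod, hermEquiv.finrank_eq, Module.finrank_prod, Module.finrank_prod,
    Module.finrank_self]
  ring

theorem finrank_octonion : Module.finrank ℝ Octonion = 8 := by
  change Module.finrank ℝ (ℍ[ℝ] × ℍ[ℝ]) = 8
  rw [Module.finrank_prod, Quaternion.finrank_eq_four]

theorem finrank_vec_examples :
    Module.finrank ℝ (Vec ℝ) = 4 ∧ Module.finrank ℝ (Vec ℂ) = 5 ∧
      Module.finrank ℝ (Vec ℍ[ℝ]) = 7 ∧ Module.finrank ℝ (Vec Octonion) = 11 := by
  refine ⟨?_, ?_, ?_, ?_⟩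
  · rw [finrank_vec, Module.finrank_self]
  · rw [finrank_vec, Complex.finrank_real_complex]
  · rw [finrank_vec, Quaternion.finrank_eq_four]
  · rw [finrank_vec, finrank_octonion]

/-! ### The form on spinors and vectors -/

/-- The Clifford action as a linear map. -/
def cliffordLinear : Vec K →ₗ[ℝ] Module.End ℝ (Spinor K) where
  toFun := cliffordAction
  map_add' v w := by
    refine LinearMap.ext fun Ψ => ?_
    have h : (v + w).toMatrix = v.toMatrix + w.toMatrix := by
      simp only [Vec.toMatrix, Matrix.fromBlocks_add, Prod.fst_add, Prod.snd_add, add_smul,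
        Submodule.coe_add, neg_add, traceReversal, Matrix.trace_add]
      congr 1
      ext i j
      simp [Matrix.diagonal_apply]
      split <;> abel
    simp [cliffordAction, h, Matrix.add_mulVec]
  map_smul' r v := by
    refine LinearMap.ext fun Ψ => ?_
    have h : (r • v).toMatrix = r • v.toMatrix := by
      simp only [Vec.toMatrix, Matrix.fromBlocks_smul, Prod.smul_fst, Prod.smul_snd, smul_assoc,
        Submodule.coe_smul, smul_neg, traceReversal, Matrix.trace_smul]
      congr 1
      ext i j
      simp [Matrix.diagonal_apply, smul_sub]
    simp [cliffordAction, h, Matrix.smul_mulVec]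

/-- The pairing of spinors as a bilinear map. -/
noncomputable def spinorPairingLinear : Spinor K →ₗ[ℝ] Spinor K →ₗ[ℝ] ℝ :=
  LinearMap.mk₂ ℝ spinorPairing
    (fun Ψ Ψ' Φ => by simp [spinorPairing])
    (fun r Ψ Φ => by simp [spinorPairing])
    (fun Ψ Φ Φ' => by simp [spinorPairing, Matrix.mulVec_add])
    (fun r Ψ Φ => by simp [spinorPairing, Matrix.mulVec_smul])

theorem spinorPairingLinear_apply (Ψ Φ : Spinor K) :
    spinorPairingLinear Ψ Φ = spinorPairing Ψ Φ := rfl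

/-- `⟨Ψ, (v w - w v) Φ⟩` as a multilinear function of `v`, `w`, `Ψ`, `Φ`. -/
noncomputable def membraneForm :
    Vec K →ₗ[ℝ] Vec K →ₗ[ℝ] Spinor K →ₗ[ℝ] Spinor K →ₗ[ℝ] ℝ :=
  LinearMap.mk₂ ℝ (fun v w => spinorPairingLinear.compl₂ ⁅cliffordLinear v, cliffordLinear w⁆)
    (fun v v' w => LinearMap.ext₂ fun Ψ Φ => by simp [Ring.lie_def, mul_add, add_mul]; ring)
    (fun r v w => LinearMap.ext₂ fun Ψ Φ => by simp [Ring.lie_def, mul_sub])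
    (fun v w w' => LinearMap.ext₂ fun Ψ Φ => by simp [Ring.lie_def, mul_add, add_mul]; ring)
    (fun r v w => LinearMap.ext₂ fun Ψ Φ => by simp [Ring.lie_def, mul_sub])

theorem membraneForm_apply (v w : Vec K) (Ψ Φ : Spinor K) :
    membraneForm v w Ψ Φ = spinorPairing Ψ (⁅cliffordAction v, cliffordAction w⁆ Φ) := rfl

theorem membraneForm_apply_sub (v w : Vec K) (Ψ Φ : Spinor K) :
    membraneForm v w Ψ Φ = spinorPairing Ψ (cliffordAction v (cliffordAction w Φ)) -
      spinorPairing Ψ (cliffordAction w (cliffordAction v Φ)) := by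
  rw [membraneForm_apply, Ring.lie_def, LinearMap.sub_apply, ← spinorPairingLinear_apply, map_sub]
  rfl

theorem membraneForm_swap (v w : Vec K) (Ψ Φ : Spinor K) :
    membraneForm v w Ψ Φ = -membraneForm w v Ψ Φ := by
  rw [membraneForm_apply_sub, membraneForm_apply_sub, neg_sub]

/-- Exchanging the spinors in `⟨Ψ, v w Φ⟩` reverses the order of `v` and `w` and costs one sign; the
commutator absorbs both. -/
theorem membraneForm_comm (v w : Vec K) (Ψ Φ : Spinor K) :
    membraneForm v w Ψ Φ = membraneForm v w Φ Ψ := by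
  have h (v w : Vec K) (Ψ Φ : Spinor K) :
      spinorPairing Ψ (cliffordAction v (cliffordAction w Φ)) =
        -spinorPairing Φ (cliffordAction w (cliffordAction v Ψ)) := by
    rw [spinorPairing_cliffordAction_comm, spinorPairing_swap, spinorPairing_cliffordAction_comm]
  rw [membraneForm_apply_sub, membraneForm_apply_sub, h v w Ψ Φ, h w v Ψ Φ]
  ring

/-- Each of the two products in the commutator contributes `±⟨(Ψ·Ψ)Ψ, vΨ⟩`, so each vanishes
separately. -/
theorem membraneForm_spinorDot_self (v : Vec K) (Ψ : Spinor K) :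
    membraneForm (spinorDot Ψ Ψ) v Ψ Ψ = 0 := by
  have h := spinorPairing_cliffordAction_spinorDot_self v Ψ
  rw [membraneForm_apply_sub, spinorPairing_cliffordAction_comm, spinorPairing_swap, h,
    spinorPairing_cliffordAction_comm v, h]
  simp

end Algebra

/-! ## Koszul signs -/

theorem paritySign_zero : paritySign 0 = 1 := rfl

theorem paritySign_one : paritySign 1 = -1 := rfl

theorem paritySign_mul_self (p : ZMod 2) : paritySign p * paritySign p = 1 := by
  unfold paritySign
  split <;> norm_num

theorem paritySign_add (p q : ZMod 2) : paritySign (p + q) = paritySign p * paritySign q := by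
  have h : ∀ p : ZMod 2, p = 0 ∨ p = 1 := by decide
  rcases h p with rfl | rfl <;> rcases h q with rfl | rfl <;>
    simp [paritySign, (by decide : (1 + 1 : ZMod 2) = 0)]

/-- The pairs with `x.1 < x.2` represent the two-element subsets, which `τ` permutes; by symmetry
`f` is a function of the subset. -/
theorem prod_pairs_comp_perm {n : ℕ} (τ : Equiv.Perm (Fin n)) (f : Fin n → Fin n → ℝ)
    (hf : ∀ a b, f a b = f b a) :
    ∏ x : Fin n × Fin n with x.1 < x.2, f (τ x.1) (τ x.2) =
      ∏ x : Fin n × Fin n with x.1 < x.2, f x.1 x.2 := by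
  have aux (τ : Equiv.Perm (Fin n)) {a b : Fin n} (h : a < b) (h' : ¬ τ a < τ b) : τ b < τ a :=
    lt_of_le_of_ne (not_lt.1 h') fun e => h.ne' (τ.injective e)
  refine Finset.prod_bij'
    (fun x _ => if τ x.1 < τ x.2 then (τ x.1, τ x.2) else (τ x.2, τ x.1))
    (fun x _ => if τ.symm x.1 < τ.symm x.2 then (τ.symm x.1, τ.symm x.2)
      else (τ.symm x.2, τ.symm x.1))
    ?_ ?_ ?_ ?_ ?_
  all_goals
    rintro ⟨a, b⟩ hx
    simp only [Finset.mem_filter, Finset.mem_univ, true_and] at hx ⊢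
  · split_ifs with h
    · exact h
    · exact aux τ hx h
  · split_ifs with h
    · exact h
    · exact aux τ.symm hx h
  · by_cases h : τ a < τ b <;> simp [h, hx, hx.not_gt]
  · by_cases h : τ.symm a < τ.symm b <;> simp [h, hx, hx.not_gt]
  · split_ifs with h
    · rfl
    · exact hf _ _

theorem koszulSign_eq_prod {n : ℕ} (σ : Equiv.Perm (Fin n)) (d : Fin n → ZMod 2) :
    koszulSign σ d = ∏ x : Fin n × Fin n with x.1 < x.2,
      if σ x.2 < σ x.1 then paritySign (d (σ x.1) * d (σ x.2)) else 1 := by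
  rw [koszulSign, ← Finset.prod_product', Finset.prod_filter]
  refine Finset.prod_congr rfl fun x _ => ?_
  split_ifs <;> simp_all

/-- A pair is inverted by `σ * τ` exactly when one, but not both, of the following holds: `τ`
inverts it, or `σ` inverts its image under `τ`. Double inversions contribute a squared sign. -/
theorem koszulSign_mul {n : ℕ} (σ τ : Equiv.Perm (Fin n)) (d : Fin n → ZMod 2) :
    koszulSign (σ * τ) d = koszulSign σ d * koszulSign τ (fun i => d (σ i)) := by
  -- Stating inversion as an equivalence makes the factor symmetric in the pair, as reindexing by
  -- `τ` requires.
  have h : koszulSign σ d = ∏ x : Fin n × Fin n with x.1 < x.2,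
      if x.1 < x.2 ↔ σ x.2 < σ x.1 then paritySign (d (σ x.1) * d (σ x.2)) else 1 := by
    rw [koszulSign_eq_prod]
    refine Finset.prod_congr rfl fun x hx => ?_
    simp [(Finset.mem_filter.1 hx).2]
  have h' := prod_pairs_comp_perm τ
    (fun a b => if a = b then 1 else
      if a < b ↔ σ b < σ a then paritySign (d (σ a) * d (σ b)) else 1)
    (fun a b => by
      by_cases hab : a = b
      · simp [hab]
      · have hσ : σ a ≠ σ b := fun e => hab (σ.injective e)
        have : (a < b ↔ σ b < σ a) ↔ (b < a ↔ σ a < σ b) := by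
          grind
        simp only [hab, Ne.symm hab, if_false, this, mul_comm (d (σ a))])
  have h'' : ∏ x : Fin n × Fin n with x.1 < x.2, (if x.1 = x.2 then 1 else
      if x.1 < x.2 ↔ σ x.2 < σ x.1 then paritySign (d (σ x.1) * d (σ x.2)) else 1) =
      koszulSign σ d := by
    rw [h]
    refine Finset.prod_congr rfl fun x hx => ?_
    simp [(Finset.mem_filter.1 hx).2.ne]
  rw [h''] at h'
  rw [← h', koszulSign_eq_prod, koszulSign_eq_prod, ← Finset.prod_mul_distrib]
  refine Finset.prod_congr rfl fun x hx => ?_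
  have hne : τ x.1 ≠ τ x.2 := fun e => (Finset.mem_filter.1 hx).2.ne (τ.injective e)
  simp only [Equiv.Perm.mul_apply, hne, if_false]
  have hs := paritySign_mul_self (d (σ (τ x.1)) * d (σ (τ x.2)))
  by_cases h₁ : σ (τ x.2) < σ (τ x.1) <;> by_cases h₂ : τ x.2 < τ x.1
  · simp [h₁, h₂, h₂.not_gt]
  · simp [h₁, h₂, lt_of_le_of_ne (not_lt.1 h₂) hne]
  · simp [h₁, h₂, h₂.not_gt, hs]
  · simp [h₁, h₂, lt_of_le_of_ne (not_lt.1 h₂) hne]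

theorem chi_mul {n : ℕ} (σ τ : Equiv.Perm (Fin n)) (d : Fin n → ZMod 2) :
    chi (σ * τ) d = chi σ d * chi τ (fun i => d (σ i)) := by
  simp only [chi, koszulSign_mul, Equiv.Perm.sign_mul, Units.val_mul, Int.cast_mul]
  ring

theorem chi_one {n : ℕ} (d : Fin n → ZMod 2) : chi 1 d = 1 := by
  have h : koszulSign 1 d = 1 :=
    Finset.prod_eq_one fun a _ => Finset.prod_eq_one fun b _ =>
      if_neg fun h => h.1.not_gt h.2
  simp [chi, h]

/-- An adjacent transposition has exactly one inversion. -/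
theorem chi_swap_castSucc_succ {n : ℕ} (i : Fin n) (d : Fin (n + 1) → ZMod 2) :
    chi (Equiv.swap i.castSucc i.succ) d = -paritySign (d i.castSucc * d i.succ) := by
  have h : koszulSign (Equiv.swap i.castSucc i.succ) d =
      paritySign (d i.castSucc * d i.succ) := by
    have hi (a b : Fin (n + 1)) : a < b ∧ Equiv.swap i.castSucc i.succ b <
        Equiv.swap i.castSucc i.succ a ↔ a = i.castSucc ∧ b = i.succ := by
      simp only [Equiv.swap_apply_def, Fin.lt_def, Fin.ext_iff]
      split_ifs <;> simp_all <;> omega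
    rw [koszulSign, Finset.prod_eq_single i.castSucc, Finset.prod_eq_single i.succ]
    · rw [if_pos ((hi _ _).2 ⟨rfl, rfl⟩), Equiv.swap_apply_left, Equiv.swap_apply_right, mul_comm]
    · intro b _ hb
      exact if_neg fun h => hb ((hi _ _).1 h).2
    · simp
    · intro a _ ha
      exact Finset.prod_eq_one fun b _ => if_neg fun h => ha ((hi _ _).1 h).1
    · simp
  rw [chi, h, Equiv.Perm.sign_swap (Fin.castSucc_lt_succ (i := i)).ne]
  simp

/-! ### Super-skew-symmetry and homogeneous arguments -/

section Skew

variable {g R : Type*} [AddCommGroup g] [Module ℝ g] [SuperSpace g]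
  [AddCommGroup R] [Module ℝ R] [SuperSpace R]

/-- Super-skew-symmetry may be checked on adjacent transpositions. -/
theorem skew_of_adjacent {n : ℕ} (ω : MultilinearMap ℝ (fun _ : Fin (n + 1) => g) R)
    (h : ∀ (i : Fin n) (x : Fin (n + 1) → g) (p : Fin (n + 1) → ZMod 2),
      (∀ i, x i ∈ SuperSpace.part g (p i)) →
      ω (fun j => x (Equiv.swap i.castSucc i.succ j)) =
        -(paritySign (p i.castSucc * p i.succ) • ω x))
    (σ : Equiv.Perm (Fin (n + 1))) (x : Fin (n + 1) → g) (p : Fin (n + 1) → ZMod 2)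
    (hx : ∀ i, x i ∈ SuperSpace.part g (p i)) :
    ω (fun i => x (σ i)) = chi σ p • ω x := by
  have hσ : σ ∈ Submonoid.closure
      (Set.range fun i : Fin n => Equiv.swap i.castSucc i.succ) := by
    rw [Equiv.Perm.mclosure_swap_castSucc_succ]
    trivial
  induction hσ using Submonoid.closure_induction generalizing x p with
  | mem σ hσ =>
    obtain ⟨i, rfl⟩ := hσ
    rw [chi_swap_castSucc_succ, neg_smul]
    exact h i x p hx
  | one => simp [chi_one]
  | mul σ τ _ _ ihσ ihτ =>
    rw [chi_mul, mul_comm, mul_smul, ← ihσ x p hx]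
    exact ihτ (fun i => x (σ i)) (fun i => p (σ i)) fun i => hx _

/-- Homogeneous elements determine a multilinear map. -/
theorem MultilinearMap.ext_homogeneous {n : ℕ} {ω ω' : MultilinearMap ℝ (fun _ : Fin n => g) R}
    (h : ∀ (x : Fin n → g) (p : Fin n → ZMod 2), (∀ i, x i ∈ SuperSpace.part g (p i)) →
      ω x = ω' x) : ω = ω' := by
  ext x
  have hd (i : Fin n) : ∃ y z : g, y ∈ SuperSpace.part g 0 ∧ z ∈ SuperSpace.part g 1 ∧
      y + z = x i := by
    have : x i ∈ SuperSpace.part g 0 ⊔ SuperSpace.part g 1 := by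
      have h := (SuperSpace.isCompl (W := g)).sup_eq_top
      simp [SuperSpace.part, h]
    obtain ⟨y, hy, z, hz, e⟩ := Submodule.mem_sup.1 this
    exact ⟨y, z, hy, hz, e⟩
  choose y z hy hz hyz using hd
  obtain rfl : y + z = x := funext hyz
  rw [MultilinearMap.map_add_univ, MultilinearMap.map_add_univ]
  refine Finset.sum_congr rfl fun s _ => h _ (fun i => if i ∈ s then 0 else 1) fun i => ?_
  by_cases hi : i ∈ s
  · simpa [hi] using hy i
  · simpa [hi] using hz i

end Skew

/-! ### The form `β`: skew-symmetry, uniqueness and the cocycle condition -/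

section Membrane

/-- The six-term polarization of a quartic form that vanishes. -/
theorem sum_pairs_eq_zero_of_diagonal {E : Type*} [AddCommGroup E] [Module ℝ E]
    (f : E →ₗ[ℝ] E →ₗ[ℝ] E →ₗ[ℝ] E →ₗ[ℝ] ℝ)
    (h₁ : ∀ a b c d, f a b c d = f b a c d) (h₂ : ∀ a b c d, f a b c d = f a b d c)
    (h : ∀ a, f a a a a = 0) (a b c d : E) :
    f a b c d + f a c b d + f a d b c + f b c a d + f b d a c + f c d a b = 0 := by
  -- The quartic polynomial `t ↦ f` on the diagonal at `x + t y` has no `t⁰` or `t⁴` term. Its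
  -- vanishing at `t = 1, -1, 2` isolates the coefficient of `t`, which is twice this sum.
  have s₁ (x y : E) : f x x x y + f x y x x = 0 := by
    have e₁ := h (x + y)
    have e₂ := h (x + (-1 : ℝ) • y)
    have e₃ := h (x + (2 : ℝ) • y)
    simp only [map_add, map_smul, LinearMap.add_apply, LinearMap.smul_apply, smul_eq_mul,
      h] at e₁ e₂ e₃
    have r₁ := h₁ x y x x
    have r₂ := h₂ x x x y
    have r₃ := h₁ x y x y
    have r₄ := h₁ x y y x
    have r₅ := h₂ y x x y
    have r₆ := h₁ x y y y
    have r₇ := h₂ y y x y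
    linarith
  -- The part of `s₁ (x + z) y` that is linear in `z`, separated by the signs `±z`.
  have s₂ (x y z : E) :
      2 * f x z x y + f x x z y + f z y x x + 2 * f x y x z = 0 := by
    have e₁ := s₁ (x + z) y
    have e₂ := s₁ (x + (-1 : ℝ) • z) y
    have e₃ := s₁ x y
    have e₄ := s₁ z y
    simp only [map_add, map_smul, LinearMap.add_apply, LinearMap.smul_apply, smul_eq_mul] at e₁ e₂
    have r₁ := h₁ x z x y
    have r₂ := h₁ x z z y
    have r₃ := h₂ x y x z
    have r₄ := h₂ z y x z
    linarith
  -- The part bilinear in `a` and `b` is twice the required sum.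
  have e₁ := s₂ (a + b) d c
  have e₂ := s₂ a d c
  have e₃ := s₂ b d c
  simp only [map_add, LinearMap.add_apply] at e₁
  have r₁ := h₁ a b c d
  have r₂ := h₂ c d a b
  have r₃ := h₂ a d b c
  have r₄ := h₂ b d a c
  linarith

variable {K : Type*} [NonAssocRing K] [StarRing K] [Module ℝ K] [IsScalarTower ℝ K K]
  [SMulCommClass ℝ K K] [StarModule ℝ K] [NormedDivisionAlgebra K]

/-- The bracket of spinors as a bilinear map. -/
noncomputable def spinorDotLinear : Spinor K →ₗ[ℝ] Spinor K →ₗ[ℝ] Vec K :=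
  LinearMap.mk₂ ℝ spinorDot
    (fun Ψ Ψ' Φ => by simp only [spinorDot_comm _ Φ, spinorDot_add_right])
    (fun r Ψ Φ => by simp only [spinorDot_comm _ Φ, spinorDot_smul_right])
    spinorDot_add_right spinorDot_smul_right

theorem membraneForm_spinorDot_sum (v : Vec K) (Ψ₁ Ψ₂ Ψ₃ Ψ₄ : Spinor K) :
    membraneForm (spinorDot Ψ₁ Ψ₂) v Ψ₃ Ψ₄ + membraneForm (spinorDot Ψ₁ Ψ₃) v Ψ₂ Ψ₄ +
      membraneForm (spinorDot Ψ₁ Ψ₄) v Ψ₂ Ψ₃ + membraneForm (spinorDot Ψ₂ Ψ₃) v Ψ₁ Ψ₄ +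
      membraneForm (spinorDot Ψ₂ Ψ₄) v Ψ₁ Ψ₃ + membraneForm (spinorDot Ψ₃ Ψ₄) v Ψ₁ Ψ₂ = 0 :=
  sum_pairs_eq_zero_of_diagonal (spinorDotLinear.compr₂ (membraneForm.flip v))
    (fun a b c d => congrArg (fun u => membraneForm u v c d) (spinorDot_comm a b))
    (fun a b c d => membraneForm_comm (spinorDot a b) v c d)
    (membraneForm_spinorDot_self v) Ψ₁ Ψ₂ Ψ₃ Ψ₄

/-- The `(2, 2)`-form `β` on the supertranslation algebra. -/
noncomputable def membraneCochain :
    MultilinearMap ℝ (fun _ : Fin 4 => Supertranslation K) ℝ :=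
  MultilinearMap.mk' (fun x =>
    -- One summand for each choice of the two vector slots; its sign counts the exchanges that carry
    -- those vectors to the right of the spinors.
    membraneForm (x 2).1 (x 3).1 (x 0).2 (x 1).2 - membraneForm (x 1).1 (x 3).1 (x 0).2 (x 2).2
      + membraneForm (x 1).1 (x 2).1 (x 0).2 (x 3).2
      + membraneForm (x 0).1 (x 3).1 (x 1).2 (x 2).2
      - membraneForm (x 0).1 (x 2).1 (x 1).2 (x 3).2
      + membraneForm (x 0).1 (x 1).1 (x 2).2 (x 3).2)
    (fun x i y z => by fin_cases i <;> simp <;> ring)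
    (fun x i r y => by fin_cases i <;> simp <;> ring)

theorem membraneCochain_apply (x : Fin 4 → Supertranslation K) : membraneCochain x =
    membraneForm (x 2).1 (x 3).1 (x 0).2 (x 1).2 - membraneForm (x 1).1 (x 3).1 (x 0).2 (x 2).2
      + membraneForm (x 1).1 (x 2).1 (x 0).2 (x 3).2
      + membraneForm (x 0).1 (x 3).1 (x 1).2 (x 2).2
      - membraneForm (x 0).1 (x 2).1 (x 1).2 (x 3).2
      + membraneForm (x 0).1 (x 1).1 (x 2).2 (x 3).2 := rfl

theorem Supertranslation.part_cases {x : Supertranslation K} {p : ZMod 2}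
    (hx : x ∈ SuperSpace.part (Supertranslation K) p) :
    p = 0 ∧ x.2 = 0 ∨ p = 1 ∧ x.1 = 0 := by
  rcases (by decide : ∀ p : ZMod 2, p = 0 ∨ p = 1) p with rfl | rfl
  · exact Or.inl ⟨rfl, mem_part_zero.1 hx⟩
  · exact Or.inr ⟨rfl, mem_part_one.1 hx⟩

theorem membraneCochain_eq_zero (x : Fin 4 → Supertranslation K) (p : Fin 4 → ZMod 2)
    (hx : ∀ i, x i ∈ SuperSpace.part (Supertranslation K) (p i))
    (hp : Finset.card {i | p i = 1} ≠ 2) : membraneCochain x = 0 := by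
  rw [Finset.card_filter, Fin.sum_univ_four] at hp
  rw [membraneCochain_apply]
  rcases Supertranslation.part_cases (hx 0) with ⟨e₀, h₀⟩ | ⟨e₀, h₀⟩ <;>
  rcases Supertranslation.part_cases (hx 1) with ⟨e₁, h₁⟩ | ⟨e₁, h₁⟩ <;>
  rcases Supertranslation.part_cases (hx 2) with ⟨e₂, h₂⟩ | ⟨e₂, h₂⟩ <;>
  rcases Supertranslation.part_cases (hx 3) with ⟨e₃, h₃⟩ | ⟨e₃, h₃⟩ <;>
  first
  | simp only [h₀, h₁, h₂, h₃, map_zero, LinearMap.zero_apply, sub_zero, add_zero]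
    done
  | exact absurd (by simp [e₀, e₁, e₂, e₃]) hp

/-- Exchanging two vectors uses the antisymmetry of `membraneForm`, exchanging two spinors its
symmetry; in the mixed case the signs of the summands already account for the exchange. -/
theorem membraneCochain_adjacent (i : Fin 3) (x : Fin 4 → Supertranslation K)
    (p : Fin 4 → ZMod 2) (hx : ∀ i, x i ∈ SuperSpace.part (Supertranslation K) (p i)) :
    membraneCochain (fun j => x (Equiv.swap i.castSucc i.succ j)) =
      -(paritySign (p i.castSucc * p i.succ) • membraneCochain x) := by
  have hc (v w : Vec K) (Ψ Φ : Spinor K) := membraneForm_comm v w Ψ Φ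
  have hs (v w : Vec K) (Ψ Φ : Spinor K) := membraneForm_swap v w Ψ Φ
  have c₁ := hc (x 2).1 (x 3).1 (x 0).2 (x 1).2
  have c₂ := hc (x 0).1 (x 3).1 (x 1).2 (x 2).2
  have c₃ := hc (x 0).1 (x 1).1 (x 2).2 (x 3).2
  have s₁ := hs (x 0).1 (x 1).1 (x 2).2 (x 3).2
  have s₂ := hs (x 1).1 (x 2).1 (x 0).2 (x 3).2
  have s₃ := hs (x 2).1 (x 3).1 (x 0).2 (x 1).2
  rw [membraneCochain_apply, membraneCochain_apply]
  fin_cases i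
  · change membraneForm (x 2).1 (x 3).1 (x 1).2 (x 0).2
      - membraneForm (x 0).1 (x 3).1 (x 1).2 (x 2).2
      + membraneForm (x 0).1 (x 2).1 (x 1).2 (x 3).2
      + membraneForm (x 1).1 (x 3).1 (x 0).2 (x 2).2
      - membraneForm (x 1).1 (x 2).1 (x 0).2 (x 3).2
      + membraneForm (x 1).1 (x 0).1 (x 2).2 (x 3).2 = -(paritySign (p 0 * p 1) • _)
    rcases Supertranslation.part_cases (hx 0) with ⟨e₀, h₀⟩ | ⟨e₀, h₀⟩ <;>
    rcases Supertranslation.part_cases (hx 1) with ⟨e₁, h₁⟩ | ⟨e₁, h₁⟩ <;>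
    simp [e₀, e₁, h₀, h₁, paritySign_zero, paritySign_one] at c₁ s₁ ⊢ <;>
    linarith
  · change membraneForm (x 1).1 (x 3).1 (x 0).2 (x 2).2
      - membraneForm (x 2).1 (x 3).1 (x 0).2 (x 1).2
      + membraneForm (x 2).1 (x 1).1 (x 0).2 (x 3).2
      + membraneForm (x 0).1 (x 3).1 (x 2).2 (x 1).2
      - membraneForm (x 0).1 (x 1).1 (x 2).2 (x 3).2
      + membraneForm (x 0).1 (x 2).1 (x 1).2 (x 3).2 = -(paritySign (p 1 * p 2) • _)
    rcases Supertranslation.part_cases (hx 1) with ⟨e₀, h₀⟩ | ⟨e₀, h₀⟩ <;>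
    rcases Supertranslation.part_cases (hx 2) with ⟨e₁, h₁⟩ | ⟨e₁, h₁⟩ <;>
    simp [e₀, e₁, h₀, h₁, paritySign_zero, paritySign_one] at c₂ s₂ ⊢ <;>
    linarith
  · change membraneForm (x 3).1 (x 2).1 (x 0).2 (x 1).2
      - membraneForm (x 1).1 (x 2).1 (x 0).2 (x 3).2
      + membraneForm (x 1).1 (x 3).1 (x 0).2 (x 2).2
      + membraneForm (x 0).1 (x 2).1 (x 1).2 (x 3).2
      - membraneForm (x 0).1 (x 3).1 (x 1).2 (x 2).2
      + membraneForm (x 0).1 (x 1).1 (x 3).2 (x 2).2 = -(paritySign (p 2 * p 3) • _)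
    rcases Supertranslation.part_cases (hx 2) with ⟨e₀, h₀⟩ | ⟨e₀, h₀⟩ <;>
    rcases Supertranslation.part_cases (hx 3) with ⟨e₁, h₁⟩ | ⟨e₁, h₁⟩ <;>
    simp [e₀, e₁, h₀, h₁, paritySign_zero, paritySign_one] at c₃ s₃ ⊢ <;>
    linarith

theorem isMembraneForm_membraneCochain : IsMembraneForm (membraneCochain (K := K)) where
  isCochain :=
    { skew := skew_of_adjacent _ membraneCochain_adjacent
      parity := fun x p hx => by
        rw [zero_add]
        by_cases hp : Finset.card {i | p i = 1} = 2
        · have h : ∀ p : Fin 4 → ZMod 2, Finset.card {i | p i = 1} = 2 → ∑ i, p i = 0 := by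
            decide +kernel
          rw [h p hp]
          exact Submodule.mem_top
        · rw [membraneCochain_eq_zero x p hx hp]
          exact Submodule.zero_mem _ }
  eq_zero := membraneCochain_eq_zero
  apply Ψ Φ v w := by
    simp [membraneCochain_apply, membraneForm_apply]

/-- Two spinors and two vectors can be sorted into the order of `apply`, at the cost of an
invertible sign. -/
theorem IsMembraneForm.unique {β β' : MultilinearMap ℝ (fun _ : Fin 4 => Supertranslation K) ℝ}
    (h : IsMembraneForm β) (h' : IsMembraneForm β') : β = β' := by
  refine MultilinearMap.ext_homogeneous fun x p hx => ?_
  by_cases hp : Finset.card {i | p i = 1} = 2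
  · obtain ⟨σ, h₀, h₁, h₂, h₃⟩ : ∃ σ : Equiv.Perm (Fin 4),
        p (σ 0) = 1 ∧ p (σ 1) = 1 ∧ p (σ 2) = 0 ∧ p (σ 3) = 0 := by
      clear hx
      revert p
      decide +kernel
    have hc : chi σ p ≠ 0 := by
      have e := chi_mul σ σ⁻¹ p
      rw [mul_inv_cancel, chi_one] at e
      exact left_ne_zero_of_mul (e.symm ▸ one_ne_zero)
    have e : (fun i => x (σ i)) =
        ![(0, (x (σ 0)).2), (0, (x (σ 1)).2), ((x (σ 2)).1, 0), ((x (σ 3)).1, 0)] := by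
      funext i
      have hx' := hx (σ i)
      fin_cases i
      · exact Prod.ext (mem_part_one.1 (h₀ ▸ hx')) rfl
      · exact Prod.ext (mem_part_one.1 (h₁ ▸ hx')) rfl
      · exact Prod.ext rfl (mem_part_zero.1 (h₂ ▸ hx'))
      · exact Prod.ext rfl (mem_part_zero.1 (h₃ ▸ hx'))
    have hs := h.isCochain.skew σ x p hx
    have hs' := h'.isCochain.skew σ x p hx
    rw [e, h.apply] at hs
    rw [e, h'.apply, hs] at hs'
    exact smul_right_injective ℝ hc hs'
  · rw [h.eq_zero x p hx hp, h'.eq_zero x p hx hp]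

/-- The coboundary of an even `4`-cochain with trivial coefficients. -/
theorem coboundary_trivial_four {g R : Type*} [AddCommGroup g] [Module ℝ g]
    [AddCommGroup R] [Module ℝ R] (br : g → g → g) (ρ : g → R → R) (hρ : ∀ x r, ρ x r = 0)
    (ω : MultilinearMap ℝ (fun _ : Fin 4 => g) R) (x : Fin 5 → g) (p : Fin 5 → ZMod 2) :
    coboundary br ρ ω 0 x p =
      -ω ![br (x 0) (x 1), x 2, x 3, x 4]
      + paritySign (p 1 * p 2) • ω ![br (x 0) (x 2), x 1, x 3, x 4]
      - (paritySign (p 1 * p 3) * paritySign (p 2 * p 3)) • ω ![br (x 0) (x 3), x 1, x 2, x 4]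
      + (paritySign (p 1 * p 4) * paritySign (p 2 * p 4) * paritySign (p 3 * p 4)) •
        ω ![br (x 0) (x 4), x 1, x 2, x 3]
      - (paritySign (p 0 * p 1) * paritySign (p 0 * p 2)) • ω ![br (x 1) (x 2), x 0, x 3, x 4]
      + (paritySign (p 0 * p 1) * paritySign (p 0 * p 3) * paritySign (p 2 * p 3)) •
        ω ![br (x 1) (x 3), x 0, x 2, x 4]
      - (paritySign (p 0 * p 1) * paritySign (p 0 * p 4) * paritySign (p 2 * p 4) *
          paritySign (p 3 * p 4)) • ω ![br (x 1) (x 4), x 0, x 2, x 3]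
      - (paritySign (p 0 * p 2) * paritySign (p 0 * p 3) * paritySign (p 1 * p 2) *
          paritySign (p 1 * p 3)) • ω ![br (x 2) (x 3), x 0, x 1, x 4]
      + (paritySign (p 0 * p 2) * paritySign (p 0 * p 4) * paritySign (p 1 * p 2) *
          paritySign (p 1 * p 4) * paritySign (p 3 * p 4)) • ω ![br (x 2) (x 4), x 0, x 1, x 3]
      - (paritySign (p 0 * p 3) * paritySign (p 0 * p 4) * paritySign (p 1 * p 3) *
          paritySign (p 1 * p 4) * paritySign (p 2 * p 3) * paritySign (p 2 * p 4)) •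
        ω ![br (x 3) (x 4), x 0, x 1, x 2] := by
  have hs (q : ZMod 2) : ∃ s : ℝ, paritySign q = s ∧ s * s = 1 :=
    ⟨_, rfl, paritySign_mul_self q⟩
  have hv (u : g) (i : Fin 4) (j : Fin 5) :
      (Fin.cons u fun t => x (j.succAbove (i.succAbove t)) : Fin 4 → g) =
        ![u, x (j.succAbove (i.succAbove 0)), x (j.succAbove (i.succAbove 1)),
          x (j.succAbove (i.succAbove 2))] := by
    funext t
    fin_cases t <;> rfl
  simp only [coboundary, hρ, smul_zero, Finset.sum_const_zero, zero_add, hv]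
  simp [Finset.sum_filter, Fin.sum_univ_four, Fin.sum_univ_five, mul_add, paritySign_add,
    Fin.succAbove,
    paritySign_zero, mul_comm (p 1) (p 0), mul_comm (p 2) (p 0), mul_comm (p 3) (p 0),
    mul_comm (p 4) (p 0), mul_comm (p 2) (p 1), mul_comm (p 3) (p 1), mul_comm (p 4) (p 1),
    mul_comm (p 3) (p 2), mul_comm (p 4) (p 2), mul_comm (p 4) (p 3)]
  obtain ⟨s01, e01, h01⟩ := hs (p 0 * p 1)
  obtain ⟨s02, e02, h02⟩ := hs (p 0 * p 2)
  obtain ⟨s03, e03, h03⟩ := hs (p 0 * p 3)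
  obtain ⟨s04, e04, h04⟩ := hs (p 0 * p 4)
  obtain ⟨s12, e12, h12⟩ := hs (p 1 * p 2)
  obtain ⟨s13, e13, h13⟩ := hs (p 1 * p 3)
  obtain ⟨s14, e14, h14⟩ := hs (p 1 * p 4)
  obtain ⟨s23, e23, h23⟩ := hs (p 2 * p 3)
  obtain ⟨s24, e24, h24⟩ := hs (p 2 * p 4)
  obtain ⟨s34, e34, h34⟩ := hs (p 3 * p 4)
  simp only [e01, e02, e03, e04, e12, e13, e14, e23, e24, e34]
  -- In the summand for `i < j` the sign of `p i * p j` occurs twice, once explicitly and once in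
  -- moving `x j` past `x i`; `hij` removes its square.
  linear_combination (norm := module) (-(h01)) • ω ![br (x 0) (x 1), x 2, x 3, x 4]
    + (s12 * h02) • ω ![br (x 0) (x 2), x 1, x 3, x 4]
    + (-(s13 * s23 * h03)) • ω ![br (x 0) (x 3), x 1, x 2, x 4]
    + (s14 * s24 * s34 * h04) • ω ![br (x 0) (x 4), x 1, x 2, x 3]
    + (-(s01 * s02 * h12)) • ω ![br (x 1) (x 2), x 0, x 3, x 4]
    + (s01 * s03 * s23 * h13) • ω ![br (x 1) (x 3), x 0, x 2, x 4]
    + (-(s01 * s04 * s24 * s34 * h14)) • ω ![br (x 1) (x 4), x 0, x 2, x 3]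
    + (-(s02 * s12 * s03 * s13 * h23)) • ω ![br (x 2) (x 3), x 0, x 1, x 4]
    + (s02 * s12 * s04 * s14 * s34 * h24) • ω ![br (x 2) (x 4), x 0, x 1, x 3]
    + (-(s03 * s13 * s23 * s04 * s14 * s24 * h34)) • ω ![br (x 3) (x 4), x 0, x 1, x 2]

set_option maxHeartbeats 2000000 in
-- A nonzero term needs two spinors to bracket into a vector, and then one more vector and two more
-- spinors.
theorem isCocycle_membraneCochain :
    IsCocycle (fun x y => LieSuperalgebra.bracket x y)
      (fun x r => (SuperRepresentation.trivial (Supertranslation K) ℝ).map x r)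
      (membraneCochain (K := K)) 0 := by
  refine ⟨isMembraneForm_membraneCochain.isCochain, fun x p hx => ?_⟩
  rw [coboundary_trivial_four _
    (fun x r => (SuperRepresentation.trivial (Supertranslation K) ℝ).map x r)
    fun _ _ => rfl]
  simp only [membraneCochain_apply, LieSuperalgebra.bracket, supertranslationBracket_apply]
  have h := membraneForm_spinorDot_sum (K := K)
  -- One six-term identity for each position of the single vector.
  have h₀ := h (x 0).1 (x 1).2 (x 2).2 (x 3).2 (x 4).2
  have h₁ := h (x 1).1 (x 0).2 (x 2).2 (x 3).2 (x 4).2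
  have h₂ := h (x 2).1 (x 0).2 (x 1).2 (x 3).2 (x 4).2
  have h₃ := h (x 3).1 (x 0).2 (x 1).2 (x 2).2 (x 4).2
  have h₄ := h (x 4).1 (x 0).2 (x 1).2 (x 2).2 (x 3).2
  clear h
  rcases Supertranslation.part_cases (hx 0) with ⟨e₀, v₀⟩ | ⟨e₀, v₀⟩ <;>
  rcases Supertranslation.part_cases (hx 1) with ⟨e₁, v₁⟩ | ⟨e₁, v₁⟩ <;>
  rcases Supertranslation.part_cases (hx 2) with ⟨e₂, v₂⟩ | ⟨e₂, v₂⟩ <;>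
  rcases Supertranslation.part_cases (hx 3) with ⟨e₃, v₃⟩ | ⟨e₃, v₃⟩ <;>
  rcases Supertranslation.part_cases (hx 4) with ⟨e₄, v₄⟩ | ⟨e₄, v₄⟩ <;>
  simp [e₀, e₁, e₂, e₃, e₄, v₀, v₁, v₂, v₃, v₄, paritySign_zero, paritySign_one,
    spinorDot_zero_left, spinorDot_zero_right] <;>
  linarith

end Membrane

/-! ## Unshuffles -/

/-- The `(2, 3)`-unshuffles, ordered lexicographically by the images of `0` and `1`. -/
def unshuffleTwoThree : Fin 10 → Equiv.Perm (Fin 5) :=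
  ![⟨![0, 1, 2, 3, 4], ![0, 1, 2, 3, 4], by decide, by decide⟩,
    ⟨![0, 2, 1, 3, 4], ![0, 2, 1, 3, 4], by decide, by decide⟩,
    ⟨![0, 3, 1, 2, 4], ![0, 2, 3, 1, 4], by decide, by decide⟩,
    ⟨![0, 4, 1, 2, 3], ![0, 2, 3, 4, 1], by decide, by decide⟩,
    ⟨![1, 2, 0, 3, 4], ![2, 0, 1, 3, 4], by decide, by decide⟩,
    ⟨![1, 3, 0, 2, 4], ![2, 0, 3, 1, 4], by decide, by decide⟩,
    ⟨![1, 4, 0, 2, 3], ![2, 0, 3, 4, 1], by decide, by decide⟩,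
    ⟨![2, 3, 0, 1, 4], ![2, 3, 0, 1, 4], by decide, by decide⟩,
    ⟨![2, 4, 0, 1, 3], ![2, 3, 0, 4, 1], by decide, by decide⟩,
    ⟨![3, 4, 0, 1, 2], ![2, 3, 4, 0, 1], by decide, by decide⟩]

/-- Written out so that the Jacobi sum on five arguments can be matched term by term with
`coboundary_trivial_four`, from which it differs by an overall sign. -/
theorem sum_chi_unshuffle {R : Type*} [AddCommGroup R] [Module ℝ R] (p : Fin 5 → ZMod 2)
    (F : Fin 5 → Fin 5 → Fin 5 → Fin 5 → Fin 5 → R) :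
    ∑ σ : Equiv.Perm (Fin 5) with
        (∀ a b : Fin 5, a < b → (b : ℕ) < 1 + 1 → σ a < σ b) ∧
        (∀ a b : Fin 5, a < b → 1 + 1 ≤ (a : ℕ) → σ a < σ b),
      chi σ p • F (σ 0) (σ 1) (σ 2) (σ 3) (σ 4) =
      F 0 1 2 3 4
      - paritySign (p 1 * p 2) • F 0 2 1 3 4
      + (paritySign (p 1 * p 3) * paritySign (p 2 * p 3)) • F 0 3 1 2 4
      - (paritySign (p 1 * p 4) * paritySign (p 2 * p 4) * paritySign (p 3 * p 4)) • F 0 4 1 2 3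
      + (paritySign (p 0 * p 1) * paritySign (p 0 * p 2)) • F 1 2 0 3 4
      - (paritySign (p 0 * p 1) * paritySign (p 0 * p 3) * paritySign (p 2 * p 3)) • F 1 3 0 2 4
      + (paritySign (p 0 * p 1) * paritySign (p 0 * p 4) * paritySign (p 2 * p 4) *
          paritySign (p 3 * p 4)) • F 1 4 0 2 3
      + (paritySign (p 0 * p 2) * paritySign (p 0 * p 3) * paritySign (p 1 * p 2) *
          paritySign (p 1 * p 3)) • F 2 3 0 1 4
      - (paritySign (p 0 * p 2) * paritySign (p 0 * p 4) * paritySign (p 1 * p 2) *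
          paritySign (p 1 * p 4) * paritySign (p 3 * p 4)) • F 2 4 0 1 3
      + (paritySign (p 0 * p 3) * paritySign (p 0 * p 4) * paritySign (p 1 * p 3) *
          paritySign (p 1 * p 4) * paritySign (p 2 * p 3) *
          paritySign (p 2 * p 4)) • F 3 4 0 1 2 := by
  have h : (Finset.univ.filter fun σ : Equiv.Perm (Fin 5) =>
        (∀ a b : Fin 5, a < b → (b : ℕ) < 1 + 1 → σ a < σ b) ∧
        (∀ a b : Fin 5, a < b → 1 + 1 ≤ (a : ℕ) → σ a < σ b)) =
      Finset.univ.image unshuffleTwoThree := by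
    decide +kernel
  have hinj : Function.Injective unshuffleTwoThree := by
    unfold Function.Injective
    decide +kernel
  have hs (k : Fin 10) : Equiv.Perm.sign (unshuffleTwoThree k) =
      ![1, -1, 1, -1, 1, -1, 1, 1, -1, 1] k := by
    revert k
    decide +kernel
  have c0 : chi (unshuffleTwoThree 0) p = 1 := by
    rw [chi, hs]
    simp [koszulSign, Fin.prod_univ_five, unshuffleTwoThree]
  have c1 : chi (unshuffleTwoThree 1) p = -paritySign (p 2 * p 1) := by
    rw [chi, hs]
    simp [koszulSign, Fin.prod_univ_five, unshuffleTwoThree]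
  have c2 : chi (unshuffleTwoThree 2) p = paritySign (p 3 * p 1) * paritySign (p 3 * p 2) := by
    rw [chi, hs]
    simp [koszulSign, Fin.prod_univ_five, unshuffleTwoThree]
  have c3 : chi (unshuffleTwoThree 3) p = -(paritySign (p 4 * p 1) * paritySign (p 4 * p 2) *
      paritySign (p 4 * p 3)) := by
    rw [chi, hs]
    simp [koszulSign, Fin.prod_univ_five, unshuffleTwoThree]
  have c4 : chi (unshuffleTwoThree 4) p = paritySign (p 1 * p 0) * paritySign (p 2 * p 0) := by
    rw [chi, hs]
    simp [koszulSign, Fin.prod_univ_five, unshuffleTwoThree]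
  have c5 : chi (unshuffleTwoThree 5) p = -(paritySign (p 1 * p 0) * paritySign (p 3 * p 0) *
      paritySign (p 3 * p 2)) := by
    rw [chi, hs]
    simp [koszulSign, Fin.prod_univ_five, unshuffleTwoThree]
    ring
  have c6 : chi (unshuffleTwoThree 6) p = paritySign (p 1 * p 0) * paritySign (p 4 * p 0) *
      paritySign (p 4 * p 2) * paritySign (p 4 * p 3) := by
    rw [chi, hs]
    simp [koszulSign, Fin.prod_univ_five, unshuffleTwoThree]
    ring
  have c7 : chi (unshuffleTwoThree 7) p = paritySign (p 2 * p 0) * paritySign (p 2 * p 1) *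
      paritySign (p 3 * p 0) * paritySign (p 3 * p 1) := by
    rw [chi, hs]
    simp [koszulSign, Fin.prod_univ_five, unshuffleTwoThree]
    ring
  have c8 : chi (unshuffleTwoThree 8) p = -(paritySign (p 2 * p 0) * paritySign (p 2 * p 1) *
      paritySign (p 4 * p 0) * paritySign (p 4 * p 1) * paritySign (p 4 * p 3)) := by
    rw [chi, hs]
    simp [koszulSign, Fin.prod_univ_five, unshuffleTwoThree]
    ring
  have c9 : chi (unshuffleTwoThree 9) p = paritySign (p 3 * p 0) * paritySign (p 3 * p 1) *
      paritySign (p 3 * p 2) * paritySign (p 4 * p 0) * paritySign (p 4 * p 1) * paritySign (p 4 *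
          p 2) := by
    rw [chi, hs]
    simp [koszulSign, Fin.prod_univ_five, unshuffleTwoThree]
    ring
  have hsum (G : Fin 10 → R) :
      ∑ k, G k = G 0 + G 1 + G 2 + G 3 + G 4 + G 5 + G 6 + G 7 + G 8 + G 9 := by
    rw [Fin.sum_univ_castSucc, Fin.sum_univ_castSucc, Fin.sum_univ_eight]
    rfl
  rw [h, Finset.sum_image hinj.injOn]
  simp only [hsum, c0, c1, c2, c3, c4, c5, c6, c7, c8, c9, mul_comm (p 1) (p 0),
    mul_comm (p 2) (p 0), mul_comm (p 3) (p 0), mul_comm (p 4) (p 0), mul_comm (p 2) (p 1),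
    mul_comm (p 3) (p 1), mul_comm (p 4) (p 1), mul_comm (p 3) (p 2), mul_comm (p 4) (p 2),
    mul_comm (p 4) (p 3)]
  simp [unshuffleTwoThree]
  module

/-! ## Operations concentrated in degree zero -/

section DegreeZero

universe u

variable {V : ℕ → Type u} [∀ q, AddCommGroup (V q)] [∀ q, Module ℝ (V q)]

/-- The operation on `⨁ q, V q` that applies a multilinear map `V 0 × ⋯ × V 0 → V r` to the
components of degree `0`. -/
noncomputable def degreeZeroOp {k : ℕ} (r : ℕ) (c : MultilinearMap ℝ (fun _ : Fin k => V 0) (V r)) :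
    MultilinearMap ℝ (fun _ : Fin k => ⨁ q, V q) (⨁ q, V q) :=
  (DirectSum.lof ℝ ℕ V r).compMultilinearMap
    (c.compLinearMap fun _ => DirectSum.component ℝ ℕ V 0)

theorem degreeZeroOp_apply {k : ℕ} (r : ℕ) (c : MultilinearMap ℝ (fun _ : Fin k => V 0) (V r))
    (y : Fin k → ⨁ q, V q) :
    degreeZeroOp r c y = DirectSum.of V r (c fun i => y i 0) := rfl

theorem degreeZeroOp_of {k : ℕ} (r : ℕ) (c : MultilinearMap ℝ (fun _ : Fin k => V 0) (V r))
    (x : Fin k → V 0) : degreeZeroOp r c (fun i => DirectSum.of V 0 (x i)) =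
      DirectSum.of V r (c x) := by
  rw [degreeZeroOp_apply]
  simp only [DirectSum.of_eq_same]

theorem degreeZeroOp_eq_zero {k : ℕ} (r : ℕ) (c : MultilinearMap ℝ (fun _ : Fin k => V 0) (V r))
    (y : Fin k → ⨁ q, V q) (i : Fin k) (hi : y i 0 = 0) : degreeZeroOp r c y = 0 := by
  rw [degreeZeroOp_apply, c.map_coord_zero i hi, map_zero]

theorem degreeZeroOp_degree {k : ℕ} (r : ℕ) (c : MultilinearMap ℝ (fun _ : Fin k => V 0) (V r))
    (hk : r + 2 = k) (q : Fin k → ℕ) (x : ∀ i, V (q i)) (s : ℕ) (hs : s + 2 ≠ (∑ i, q i) + k) :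
    degreeZeroOp r c (fun i => DirectSum.of V (q i) (x i)) s = 0 := by
  by_cases hq : ∀ i, q i = 0
  · obtain rfl : q = fun _ => 0 := funext hq
    rw [degreeZeroOp_of]
    refine DirectSum.of_eq_of_ne _ _ _ fun e => hs ?_
    simp [e, hk]
  · push Not at hq
    obtain ⟨i, hi⟩ := hq
    rw [degreeZeroOp_eq_zero r c _ i (DirectSum.of_eq_of_ne _ _ _ (Ne.symm hi))]
    rfl

variable [∀ q, SuperSpace (V q)]

theorem degreeZeroOp_parity {k : ℕ} (r : ℕ) (c : MultilinearMap ℝ (fun _ : Fin k => V 0) (V r))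
    (hc : IsCochain c 0) (q : Fin k → ℕ) (p : Fin k → ZMod 2) (x : ∀ i, V (q i))
    (hx : ∀ i, x i ∈ SuperSpace.part (V (q i)) (p i)) (s : ℕ) :
    degreeZeroOp r c (fun i => DirectSum.of V (q i) (x i)) s ∈
      SuperSpace.part (V s) (∑ i, p i) := by
  by_cases hq : ∀ i, q i = 0
  · obtain rfl : q = fun _ => 0 := funext hq
    rw [degreeZeroOp_of]
    by_cases hs : s = r
    · subst hs
      rw [DirectSum.of_eq_same]
      simpa using hc.parity x p hx
    · rw [DirectSum.of_eq_of_ne _ _ _ hs]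
      exact Submodule.zero_mem _
  · push Not at hq
    obtain ⟨i, hi⟩ := hq
    rw [degreeZeroOp_eq_zero r c _ i (DirectSum.of_eq_of_ne _ _ _ (Ne.symm hi))]
    exact Submodule.zero_mem _

theorem degreeZeroOp_antisymm {k : ℕ} (r : ℕ) (c : MultilinearMap ℝ (fun _ : Fin k => V 0) (V r))
    (hc : IsCochain c 0) (q : Fin k → ℕ) (p : Fin k → ZMod 2) (x : ∀ i, V (q i))
    (hx : ∀ i, x i ∈ SuperSpace.part (V (q i)) (p i)) (σ : Equiv.Perm (Fin k)) :
    degreeZeroOp r c (fun i => DirectSum.of V (q (σ i)) (x (σ i))) =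
      chi σ (fun i => (q i : ZMod 2) + p i) •
        degreeZeroOp r c (fun i => DirectSum.of V (q i) (x i)) := by
  by_cases hq : ∀ i, q i = 0
  · obtain rfl : q = fun _ => 0 := funext hq
    rw [degreeZeroOp_of r c fun i => x (σ i), degreeZeroOp_of r c x, hc.skew σ x p hx]
    simp only [Nat.cast_zero, zero_add]
    exact (DirectSum.lof ℝ ℕ V r).map_smul _ _
  · push Not at hq
    obtain ⟨i, hi⟩ := hq
    rw [degreeZeroOp_eq_zero r c (fun i => DirectSum.of V (q i) (x i)) i
      (DirectSum.of_eq_of_ne _ _ _ (Ne.symm hi)), degreeZeroOp_eq_zero r c _ (σ.symm i), smul_zero]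
    refine DirectSum.of_eq_of_ne _ _ _ ?_
    rw [Equiv.apply_symm_apply]
    exact Ne.symm hi

/-! ## Lie `3`-superalgebras from nilpotent brackets and `4`-cocycles -/

variable (b : MultilinearMap ℝ (fun _ : Fin 2 => V 0) (V 0))
  (ω : MultilinearMap ℝ (fun _ : Fin 4 => V 0) (V 2))

/-- The operations given by a bracket on `V 0` and a `4`-cochain on `V 0` with values in `V 2`. -/
noncomputable def bracketCochainOp :
    ∀ k, MultilinearMap ℝ (fun _ : Fin k => ⨁ q, V q) (⨁ q, V q)
  | 2 => degreeZeroOp 0 b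
  | 4 => degreeZeroOp 2 ω
  | _ => 0

theorem bracketCochainOp_two : bracketCochainOp b ω 2 = degreeZeroOp 0 b := rfl

theorem bracketCochainOp_four : bracketCochainOp b ω 4 = degreeZeroOp 2 ω := rfl

theorem bracketCochainOp_of_ne {k : ℕ} (h₂ : k ≠ 2) (h₄ : k ≠ 4) : bracketCochainOp b ω k = 0 := by
  unfold bracketCochainOp
  split
  · exact absurd rfl h₂
  · exact absurd rfl h₄
  · rfl

theorem bracketCochainOp_eq_zero {k : ℕ} (y : Fin k → ⨁ q, V q) (i : Fin k) (hi : y i 0 = 0) :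
    bracketCochainOp b ω k y = 0 := by
  by_cases h₂ : k = 2
  · subst h₂
    exact degreeZeroOp_eq_zero 0 b y i hi
  by_cases h₄ : k = 4
  · subst h₄
    exact degreeZeroOp_eq_zero 2 ω y i hi
  rw [bracketCochainOp_of_ne b ω h₂ h₄]
  rfl

/-- Only the binary operation has output in degree 0, so only it can be the inner operation of a
nonzero composite. -/
theorem bracketCochainOp_apply_zero {k : ℕ} (h₂ : k ≠ 2) (y : Fin k → ⨁ q, V q) :
    bracketCochainOp b ω k y 0 = 0 := by
  by_cases h₄ : k = 4
  · subst h₄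
    rw [bracketCochainOp_four, degreeZeroOp_apply]
    exact DirectSum.of_eq_of_ne _ _ _ (by decide)
  rw [bracketCochainOp_of_ne b ω h₂ h₄]
  rfl

theorem sum_chi_eq_zero_of_cocycle
    (hω : ∀ (x : Fin 5 → V 0) (p : Fin 5 → ZMod 2), (∀ i, x i ∈ SuperSpace.part (V 0) (p i)) →
      coboundary (fun x y => b ![x, y]) (fun _ _ => 0) ω 0 x p = 0)
    (x : Fin 5 → V 0) (p : Fin 5 → ZMod 2) (hx : ∀ i, x i ∈ SuperSpace.part (V 0) (p i)) :
    ∑ σ : Equiv.Perm (Fin 5) with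
        (∀ a b : Fin 5, a < b → (b : ℕ) < 1 + 1 → σ a < σ b) ∧
        (∀ a b : Fin 5, a < b → 1 + 1 ≤ (a : ℕ) → σ a < σ b),
      chi σ p • ω ![b ![x (σ 0), x (σ 1)], x (σ 2), x (σ 3), x (σ 4)] = 0 := by
  have h := hω x p hx
  rw [coboundary_trivial_four _ (fun _ _ => 0) fun _ _ => rfl] at h
  rw [sum_chi_unshuffle p fun i j k l m => ω ![b ![x i, x j], x k, x l, x m], ← neg_eq_zero, ← h]
  abel

theorem bracketCochainOp_four_two (z : Fin 4 → ⨁ q, V q) (y : Fin 2 → ⨁ q, V q) :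
    bracketCochainOp b ω 4 (fun t => if (t : ℕ) = 0 then bracketCochainOp b ω 2 y else z t) =
      DirectSum.of V 2 (ω ![b ![y 0 0, y 1 0], z 1 0, z 2 0, z 3 0]) := by
  rw [bracketCochainOp_four, bracketCochainOp_two, degreeZeroOp_apply, degreeZeroOp_apply]
  congr 2
  funext t
  fin_cases t
  · refine (DirectSum.of_eq_same _ _).trans (congrArg b ?_)
    funext s
    fin_cases s <;> rfl
  all_goals rfl

theorem bracketCochainOp_two_two (hb : ∀ x y z, b ![b ![x, y], z] = 0)
    (z : Fin 2 → ⨁ q, V q) (y : Fin 2 → ⨁ q, V q) :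
    bracketCochainOp b ω 2 (fun t => if (t : ℕ) = 0 then bracketCochainOp b ω 2 y else z t) =
      0 := by
  rw [bracketCochainOp_two, degreeZeroOp_apply, degreeZeroOp_apply,
    ← map_zero (DirectSum.of V 0), ← hb (y 0 0) (y 1 0) (z 1 0)]
  congr 2
  funext t
  fin_cases t
  · refine (DirectSum.of_eq_same _ _).trans (congrArg b ?_)
    funext s
    fin_cases s <;> rfl
  · rfl

/-- The inner operation is binary, so the outer one has arity `n - 1`, which must be 2 or 4. For `n
= 3` each term vanishes by nilpotency; for `n = 5` the sum is minus the coboundary of `ω`. -/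
theorem bracketCochainOp_jacobi
    (hb : ∀ x y z, b ![b ![x, y], z] = 0)
    (hω : ∀ (x : Fin 5 → V 0) (p : Fin 5 → ZMod 2), (∀ i, x i ∈ SuperSpace.part (V 0) (p i)) →
      coboundary (fun x y => b ![x, y]) (fun _ _ => 0) ω 0 x p = 0)
    (n : ℕ) (q : Fin n → ℕ) (p : Fin n → ZMod 2) (x : ∀ i, V (q i))
    (hx : ∀ i, x i ∈ SuperSpace.part (V (q i)) (p i)) :
    ∑ i : Fin n, ∑ σ : Equiv.Perm (Fin n) with
        (∀ a b : Fin n, a < b → (b : ℕ) < i + 1 → σ a < σ b) ∧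
        (∀ a b : Fin n, a < b → (i : ℕ) + 1 ≤ a → σ a < σ b),
      (chi σ (fun a => (q a : ZMod 2) + p a) * (-1 : ℝ) ^ (((i : ℕ) + 1) * (n - (i + 1)))) •
        bracketCochainOp b ω (n - i) (fun t =>
          if (t : ℕ) = 0 then
            bracketCochainOp b ω (i + 1) (fun s =>
              DirectSum.of V (q (σ ⟨s, by omega⟩)) (x (σ ⟨s, by omega⟩)))
          else
            DirectSum.of V (q (σ ⟨i + t, by omega⟩)) (x (σ ⟨i + t, by omega⟩))) = 0 := by
  have hzero (i : Fin n) (hi : (i : ℕ) ≠ 1) (y : Fin (i + 1) → ⨁ q, V q)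
      (z : Fin (n - i) → ⨁ q, V q) : bracketCochainOp b ω (n - i) (fun t =>
        if (t : ℕ) = 0 then bracketCochainOp b ω (i + 1) y else z t) = 0 :=
    bracketCochainOp_eq_zero b ω _ ⟨0, by omega⟩
      (bracketCochainOp_apply_zero b ω (by omega) y)
  by_cases hn : n = 5
  · subst hn
    rw [Fin.sum_univ_five]
    simp only [hzero _ (show ((0 : Fin 5) : ℕ) ≠ 1 by decide),
      hzero _ (show ((2 : Fin 5) : ℕ) ≠ 1 by decide), hzero _ (show ((3 : Fin 5) : ℕ) ≠ 1 by decide),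
      hzero _ (show ((4 : Fin 5) : ℕ) ≠ 1 by decide), smul_zero, Finset.sum_const_zero, zero_add,
      add_zero]
    have key (σ : Equiv.Perm (Fin 5)) := bracketCochainOp_four_two b ω
      (fun t => DirectSum.of V (q (σ ⟨1 + t, by omega⟩)) (x (σ ⟨1 + t, by omega⟩)))
      (fun s => DirectSum.of V (q (σ ⟨s, by omega⟩)) (x (σ ⟨s, by omega⟩)))
    refine (Finset.sum_congr rfl fun σ _ => congrArg _ (key σ)).trans ?_
    by_cases hq : ∀ i, q i = 0
    · obtain rfl : q = fun _ => 0 := funext hq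
      have h := congrArg (DirectSum.lof ℝ ℕ V 2) (sum_chi_eq_zero_of_cocycle b ω hω x p hx)
      rw [map_sum, map_zero] at h
      rw [← h]
      refine Finset.sum_congr rfl fun σ _ => ?_
      rw [map_smul]
      congr 1
      -- The factor `(-1) ^ (2 * 3)` is `1`, and in degree 0 the overall grade is the parity.
      simp
      norm_num
    · push Not at hq
      obtain ⟨j, hj⟩ := hq
      refine Finset.sum_eq_zero fun σ _ => ?_
      obtain ⟨k, rfl⟩ := σ.surjective j
      -- An argument of positive degree has no component in degree 0, so it kills the composite from
      -- any slot.
      have h : DirectSum.of V (q (σ k)) (x (σ k)) 0 = 0 :=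
        DirectSum.of_eq_of_ne _ _ _ (Ne.symm hj)
      refine (congrArg _ ((congrArg (DirectSum.of V 2) ?_).trans (map_zero _))).trans
        (smul_zero _)
      fin_cases k
      · exact ω.map_coord_zero 0 (b.map_coord_zero 0 h)
      · exact ω.map_coord_zero 0 (b.map_coord_zero 1 h)
      · exact ω.map_coord_zero 1 h
      · exact ω.map_coord_zero 2 h
      · exact ω.map_coord_zero 3 h
  · refine Finset.sum_eq_zero fun i _ => Finset.sum_eq_zero fun σ _ => ?_
    by_cases hi : (i : ℕ) = 1
    · refine (congrArg _ ?_).trans (smul_zero _)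
      by_cases h3 : n = 3
      · subst h3
        obtain rfl : i = 1 := Fin.ext hi
        exact bracketCochainOp_two_two b ω hb _ _
      · rw [bracketCochainOp_of_ne b ω (by omega) (by omega)]
        rfl
    · rw [hzero i hi, smul_zero]

/-- The Lie `3`-superalgebra given by a nilpotent bracket on `V 0` and a `4`-cocycle on `V 0` with
trivial coefficients `V 2`. -/
noncomputable def LInftySuperalgebra.ofBracketCocycle (hb : IsCochain b 0) (hc : IsCochain ω 0)
    (hb' : ∀ x y z, b ![b ![x, y], z] = 0)
    (hω : ∀ (x : Fin 5 → V 0) (p : Fin 5 → ZMod 2), (∀ i, x i ∈ SuperSpace.part (V 0) (p i)) →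
      coboundary (fun x y => b ![x, y]) (fun _ _ => 0) ω 0 x p = 0) :
    LInftySuperalgebra.{u} where
  V := V
  l := bracketCochainOp b ω
  l_zero := rfl
  degree k q x r hr := by
    by_cases h₂ : k = 2
    · subst h₂
      exact degreeZeroOp_degree 0 b rfl q x r hr
    by_cases h₄ : k = 4
    · subst h₄
      exact degreeZeroOp_degree 2 ω rfl q x r hr
    rw [bracketCochainOp_of_ne b ω h₂ h₄]
    rfl
  parity k q p x hx r := by
    by_cases h₂ : k = 2
    · subst h₂
      exact degreeZeroOp_parity 0 b hb q p x hx r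
    by_cases h₄ : k = 4
    · subst h₄
      exact degreeZeroOp_parity 2 ω hc q p x hx r
    rw [bracketCochainOp_of_ne b ω h₂ h₄]
    exact Submodule.zero_mem _
  antisymm k q p x hx σ := by
    by_cases h₂ : k = 2
    · subst h₂
      exact degreeZeroOp_antisymm 0 b hb q p x hx σ
    by_cases h₄ : k = 4
    · subst h₄
      exact degreeZeroOp_antisymm 2 ω hc q p x hx σ
    rw [bracketCochainOp_of_ne b ω h₂ h₄]
    simp
  jacobi := bracketCochainOp_jacobi b ω hb' hω

section OfBracketCocycle

variable {b ω} {hb : IsCochain b 0} {hc : IsCochain ω 0} {hb' : ∀ x y z, b ![b ![x, y], z] = 0}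
  {hω : ∀ (x : Fin 5 → V 0) (p : Fin 5 → ZMod 2), (∀ i, x i ∈ SuperSpace.part (V 0) (p i)) →
    coboundary (fun x y => b ![x, y]) (fun _ _ => 0) ω 0 x p = 0}

theorem LInftySuperalgebra.ofBracketCocycle_bracket (x y : V 0) :
    (ofBracketCocycle b ω hb hc hb' hω).bracket x y = b ![x, y] := by
  refine (congrArg (fun z : ⨁ q, V q => z 0)
    (degreeZeroOp_apply 0 b ![DirectSum.of V 0 x, DirectSum.of V 0 y])).trans ?_
  refine (DirectSum.of_eq_same _ _).trans (congrArg b (funext fun i => ?_))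
  fin_cases i <;> exact DirectSum.of_eq_same _ _

theorem LInftySuperalgebra.ofBracketCocycle_action (x : V 0) (r : V 2) :
    (ofBracketCocycle b ω hb hc hb' hω).action 2 x r = (0 : V 2) :=
  (congrArg (fun z : ⨁ q, V q => z 2)
    (degreeZeroOp_apply 0 b ![DirectSum.of V 0 x, DirectSum.of V 2 r])).trans
    (DirectSum.of_eq_of_ne _ _ _ (by decide))

theorem LInftySuperalgebra.ofBracketCocycle_topCochain (x : Fin 4 → V 0) :
    (ofBracketCocycle b ω hb hc hb' hω).topCochain 2 x = ω x :=
  (congrArg (fun z : ⨁ q, V q => z 2) (degreeZeroOp_of 2 ω x)).trans (DirectSum.of_eq_same _ _)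

end OfBracketCocycle

theorem degreeZeroOp_lmap {V' : ℕ → Type u} [∀ q, AddCommGroup (V' q)] [∀ q, Module ℝ (V' q)]
    (f : ∀ q, V q →ₗ[ℝ] V' q) {k : ℕ} (r : ℕ)
    (c : MultilinearMap ℝ (fun _ : Fin k => V 0) (V r))
    (c' : MultilinearMap ℝ (fun _ : Fin k => V' 0) (V' r))
    (h : ∀ x, f r (c x) = c' fun i => f 0 (x i)) (y : Fin k → ⨁ q, V q) :
    DirectSum.lmap f (degreeZeroOp r c y) = degreeZeroOp r c' fun i => DirectSum.lmap f (y i) := by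
  rw [degreeZeroOp_apply, degreeZeroOp_apply]
  simp only [DirectSum.lmap_apply, ← h]
  exact DirectSum.lmap_lof f r _

end DegreeZero

/-! ## Two-term complexes in degrees `0` and `2` -/

/-- The graded vector space with `W₀` in degree `0` and `W₂` in degree `2`. -/
def TwoTerm (W₀ W₂ : Type) : ℕ → Type
  | 0 => W₀
  | 1 => PUnit
  | 2 => W₂
  | _ + 3 => PUnit

section TwoTerm

instance : SuperSpace PUnit.{1} := ⟨⊤, ⊥, isCompl_top_bot⟩

variable (W₀ W₂ : Type) [AddCommGroup W₀] [AddCommGroup W₂]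

/-- The case split follows that of `TwoTerm`, so in degrees 0 and 2 the structures are
definitionally those of `W₀` and `W₂`, and identity maps can serve as the comparison isomorphisms.
-/
instance : ∀ q, AddCommGroup (TwoTerm W₀ W₂ q)
  | 0 => inferInstanceAs (AddCommGroup W₀)
  | 1 => inferInstanceAs (AddCommGroup PUnit)
  | 2 => inferInstanceAs (AddCommGroup W₂)
  | _ + 3 => inferInstanceAs (AddCommGroup PUnit)

variable [Module ℝ W₀] [Module ℝ W₂]

instance : ∀ q, Module ℝ (TwoTerm W₀ W₂ q)
  | 0 => inferInstanceAs (Module ℝ W₀)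
  | 1 => inferInstanceAs (Module ℝ PUnit)
  | 2 => inferInstanceAs (Module ℝ W₂)
  | _ + 3 => inferInstanceAs (Module ℝ PUnit)

instance [SuperSpace W₀] [SuperSpace W₂] : ∀ q, SuperSpace (TwoTerm W₀ W₂ q)
  | 0 => inferInstanceAs (SuperSpace W₀)
  | 1 => inferInstanceAs (SuperSpace PUnit)
  | 2 => inferInstanceAs (SuperSpace W₂)
  | _ + 3 => inferInstanceAs (SuperSpace PUnit)

theorem TwoTerm.subsingleton : ∀ q, q ≠ 0 → q ≠ 2 → Subsingleton (TwoTerm W₀ W₂ q)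
  | 0, h, _ => absurd rfl h
  | 1, _, _ => inferInstanceAs (Subsingleton PUnit)
  | 2, _, h => absurd rfl h
  | _ + 3, _, _ => inferInstanceAs (Subsingleton PUnit)

variable {W₀ W₂}

/-- A map of two-term complexes. -/
def TwoTerm.map {W₀' W₂' : Type} [AddCommGroup W₀'] [AddCommGroup W₂'] [Module ℝ W₀']
    [Module ℝ W₂'] (f₀ : W₀ →ₗ[ℝ] W₀') (f₂ : W₂ →ₗ[ℝ] W₂') :
    ∀ q, TwoTerm W₀ W₂ q →ₗ[ℝ] TwoTerm W₀' W₂' q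
  | 0 => f₀
  | 1 => 0
  | 2 => f₂
  | _ + 3 => 0

theorem TwoTerm.map_mem {W₀' W₂' : Type} [AddCommGroup W₀'] [AddCommGroup W₂'] [Module ℝ W₀']
    [Module ℝ W₂'] [SuperSpace W₀] [SuperSpace W₂] [SuperSpace W₀'] [SuperSpace W₂']
    {f₀ : W₀ →ₗ[ℝ] W₀'} {f₂ : W₂ →ₗ[ℝ] W₂'}
    (h₀ : ∀ p, ∀ x ∈ SuperSpace.part W₀ p, f₀ x ∈ SuperSpace.part W₀' p)
    (h₂ : ∀ p, ∀ x ∈ SuperSpace.part W₂ p, f₂ x ∈ SuperSpace.part W₂' p) :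
    ∀ (q : ℕ) (p : ZMod 2) (x : TwoTerm W₀ W₂ q), x ∈ SuperSpace.part (TwoTerm W₀ W₂ q) p →
      TwoTerm.map f₀ f₂ q x ∈ SuperSpace.part (TwoTerm W₀' W₂' q) p
  | 0, p, x, hx => h₀ p x hx
  | 1, _, _, _ => Submodule.zero_mem _
  | 2, p, x, hx => h₂ p x hx
  | _ + 3, _, _, _ => Submodule.zero_mem _

variable [SuperSpace W₀] [SuperSpace W₂]

namespace LInftySuperalgebra

variable (W₂) in
/-- A bracket on `W₀` as a bracket on the term of degree `0` of `TwoTerm W₀ W₂`. -/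
def twoTermBracket (b : MultilinearMap ℝ (fun _ : Fin 2 => W₀) W₀) :
    MultilinearMap ℝ (fun _ : Fin 2 => TwoTerm W₀ W₂ 0) (TwoTerm W₀ W₂ 0) := b

/-- A `4`-cochain on `W₀` with values in `W₂` as one on the terms of `TwoTerm W₀ W₂`. -/
def twoTermCochain (ω : MultilinearMap ℝ (fun _ : Fin 4 => W₀) W₂) :
    MultilinearMap ℝ (fun _ : Fin 4 => TwoTerm W₀ W₂ 0) (TwoTerm W₀ W₂ 2) := ω

/-- `ofBracketCocycle` for two-term complexes. -/
noncomputable def twoTerm (b : MultilinearMap ℝ (fun _ : Fin 2 => W₀) W₀)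
    (ω : MultilinearMap ℝ (fun _ : Fin 4 => W₀) W₂) (hb : IsCochain b 0) (hc : IsCochain ω 0)
    (hb' : ∀ x y z, b ![b ![x, y], z] = 0)
    (hω : ∀ (x : Fin 5 → W₀) (p : Fin 5 → ZMod 2), (∀ i, x i ∈ SuperSpace.part W₀ (p i)) →
      coboundary (fun x y => b ![x, y]) (fun _ _ => 0) ω 0 x p = 0) : LInftySuperalgebra.{0} :=
  ofBracketCocycle (twoTermBracket W₂ b) (twoTermCochain ω) hb hc hb' hω

section

variable {b : MultilinearMap ℝ (fun _ : Fin 2 => W₀) W₀}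
  {ω : MultilinearMap ℝ (fun _ : Fin 4 => W₀) W₂} {hb : IsCochain b 0} {hc : IsCochain ω 0}
  {hb' : ∀ x y z, b ![b ![x, y], z] = 0}
  {hω : ∀ (x : Fin 5 → W₀) (p : Fin 5 → ZMod 2), (∀ i, x i ∈ SuperSpace.part W₀ (p i)) →
    coboundary (fun x y => b ![x, y]) (fun _ _ => 0) ω 0 x p = 0}

theorem twoTerm_bracket (x y : W₀) : (twoTerm b ω hb hc hb' hω).bracket x y = b ![x, y] :=
  ofBracketCocycle_bracket (b := twoTermBracket W₂ b) (ω := twoTermCochain ω) (hb := hb)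
    (hc := hc) (hb' := hb') (hω := hω) x y

theorem twoTerm_action (x : W₀) (r : W₂) :
    (twoTerm b ω hb hc hb' hω).action 2 x r = (0 : W₂) :=
  ofBracketCocycle_action (b := twoTermBracket W₂ b) (ω := twoTermCochain ω) (hb := hb)
    (hc := hc) (hb' := hb') (hω := hω) x r

theorem twoTerm_topCochain (x : Fin 4 → W₀) :
    (twoTerm b ω hb hc hb' hω).topCochain 2 x = ω x :=
  ofBracketCocycle_topCochain (b := twoTermBracket W₂ b) (ω := twoTermCochain ω) (hb := hb)
    (hc := hc) (hb' := hb') (hω := hω) x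

end

/-- Maps that commute with the brackets and the cocycles give a homomorphism. -/
noncomputable def twoTermHom {W₀' W₂' : Type} [AddCommGroup W₀'] [AddCommGroup W₂'] [Module ℝ W₀']
    [Module ℝ W₂'] [SuperSpace W₀'] [SuperSpace W₂'] {f₀ : W₀ →ₗ[ℝ] W₀'} {f₂ : W₂ →ₗ[ℝ] W₂'}
    (h₀ : ∀ p, ∀ x ∈ SuperSpace.part W₀ p, f₀ x ∈ SuperSpace.part W₀' p)
    (h₂ : ∀ p, ∀ x ∈ SuperSpace.part W₂ p, f₂ x ∈ SuperSpace.part W₂' p)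
    {b : MultilinearMap ℝ (fun _ : Fin 2 => W₀) W₀}
    {ω : MultilinearMap ℝ (fun _ : Fin 4 => W₀) W₂} {hb hc hb' hω}
    {c : MultilinearMap ℝ (fun _ : Fin 2 => W₀') W₀'}
    {η : MultilinearMap ℝ (fun _ : Fin 4 => W₀') W₂'} {hb₁ hc₁ hb₁' hω₁}
    (h : ∀ x, f₀ (b x) = c fun i => f₀ (x i)) (h' : ∀ x, f₂ (ω x) = η fun i => f₀ (x i)) :
    Hom (twoTerm b ω hb hc hb' hω) (twoTerm c η hb₁ hc₁ hb₁' hω₁) where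
  map := TwoTerm.map f₀ f₂
  map_mem := TwoTerm.map_mem h₀ h₂
  map_l k y := by
    by_cases hk : k = 2
    · subst hk
      exact degreeZeroOp_lmap (TwoTerm.map f₀ f₂) 0 (twoTermBracket W₂ b) (twoTermBracket W₂' c) h y
    by_cases hk' : k = 4
    · subst hk'
      exact degreeZeroOp_lmap (TwoTerm.map f₀ f₂) 2 (twoTermCochain ω) (twoTermCochain η) h' y
    change DirectSum.lmap _ (bracketCochainOp (twoTermBracket W₂ b) (twoTermCochain ω) k y) =
      bracketCochainOp (twoTermBracket W₂' c) (twoTermCochain η) k _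
    rw [bracketCochainOp_of_ne _ _ hk hk', bracketCochainOp_of_ne _ _ hk hk']
    exact map_zero _

end LInftySuperalgebra

end TwoTerm

/-! ### Vanishing of cochains and coboundaries -/

theorem isCochain_zero {g R : Type*} [AddCommGroup g] [Module ℝ g] [SuperSpace g]
    [AddCommGroup R] [Module ℝ R] [SuperSpace R] {n : ℕ} (s : ZMod 2) :
    IsCochain (0 : MultilinearMap ℝ (fun _ : Fin n => g) R) s where
  skew σ x p _ := by simp
  parity x p _ := Submodule.zero_mem _

theorem coboundary_zero {g R : Type*} [AddCommGroup g] [Module ℝ g]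
    [AddCommGroup R] [Module ℝ R] (br : g → g → g) {n : ℕ} (s : ZMod 2) (x : Fin (n + 2) → g)
    (p : Fin (n + 2) → ZMod 2) : coboundary br (fun _ _ => (0 : R)) (n := n) 0 s x p = 0 := by
  simp [coboundary]

/-- The obstruction to exactness: a cocycle that is nonzero on pairwise commuting arguments is not a
coboundary. -/
theorem coboundary_eq_zero_of_bracket_eq_zero {g R : Type*} [AddCommGroup g] [Module ℝ g]
    [AddCommGroup R] [Module ℝ R] (br : g → g → g) {n : ℕ}
    (ω : MultilinearMap ℝ (fun _ : Fin (n + 1) => g) R) (s : ZMod 2) (x : Fin (n + 2) → g)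
    (p : Fin (n + 2) → ZMod 2) (hx : ∀ i j, i < j → br (x i) (x j) = 0) :
    coboundary br (fun _ _ => 0) ω s x p = 0 := by
  simp only [coboundary, smul_zero, Finset.sum_const_zero, zero_add]
  refine Finset.sum_eq_zero fun i _ => Finset.sum_eq_zero fun j _ => ?_
  split_ifs with h
  · rw [hx _ _ h, ω.map_coord_zero 0 (Fin.cons_zero _ _), smul_zero]
  · rfl

theorem bracketCochainOp_zero_zero {V : ℕ → Type*} [∀ q, AddCommGroup (V q)]
    [∀ q, Module ℝ (V q)] [∀ q, SuperSpace (V q)] (k : ℕ) (y : Fin k → ⨁ q, V q) :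
    bracketCochainOp (V := V) 0 0 k y = 0 := by
  by_cases h₂ : k = 2
  · subst h₂
    exact map_zero (DirectSum.of V 0)
  by_cases h₄ : k = 4
  · subst h₄
    exact map_zero (DirectSum.of V 2)
  rw [bracketCochainOp_of_ne _ _ h₂ h₄]
  rfl

/-! ## The supermembrane Lie `3`-superalgebra -/

section Supermembrane

variable {K : Type} [NonAssocRing K] [StarRing K] [Module ℝ K] [IsScalarTower ℝ K K]
  [SMulCommClass ℝ K K] [StarModule ℝ K] [NormedDivisionAlgebra K]

/-- The bracket of the supertranslation algebra as a `2`-cochain. -/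
noncomputable def supertranslationCochain :
    MultilinearMap ℝ (fun _ : Fin 2 => Supertranslation K) (Supertranslation K) :=
  MultilinearMap.mk' (fun x => supertranslationBracket (x 0) (x 1))
    (fun x i y z => by fin_cases i <;> simp)
    (fun x i r y => by fin_cases i <;> simp)

theorem supertranslationCochain_apply (x : Fin 2 → Supertranslation K) :
    supertranslationCochain x = (spinorDot (x 0).2 (x 1).2, 0) := rfl

theorem isCochain_supertranslationCochain :
    IsCochain (supertranslationCochain (K := K)) 0 where
  skew := skew_of_adjacent _ fun i x p hx => by
    obtain rfl : i = 0 := Subsingleton.elim _ _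
    exact LieSuperalgebra.bracket_skew _ _ _ _ (hx 1) (hx 0) |>.trans
      (by rw [mul_comm]; rfl)
  parity x p hx := by
    rw [zero_add, Fin.sum_univ_two]
    exact LieSuperalgebra.bracket_mem _ _ _ _ (hx 0) (hx 1)

/-- Brackets are vectors, and vectors are central. -/
theorem supertranslationCochain_nilpotent (x y z : Supertranslation K) :
    supertranslationCochain ![supertranslationCochain ![x, y], z] = 0 := by
  simp [supertranslationCochain_apply, spinorDot_zero_left]

variable (K)

/-- The Lie `3`-superalgebra extending the supertranslation algebra by the cocycle `β`. -/
noncomputable def supermembrane : LInftySuperalgebra.{0} :=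
  LInftySuperalgebra.twoTerm (supertranslationCochain (K := K)) membraneCochain
    isCochain_supertranslationCochain isMembraneForm_membraneCochain.isCochain
    supertranslationCochain_nilpotent isCocycle_membraneCochain.2

theorem supermembrane_isLieSuperalgebra : (supermembrane K).IsLieSuperalgebra 3 := fun q hq =>
  TwoTerm.subsingleton _ _ q (by omega) (by omega)

theorem supermembrane_isTwoTerm : (supermembrane K).IsTwoTerm 2 :=
  ⟨TwoTerm.subsingleton _ _, rfl⟩

theorem supermembrane_bracket (x y : Supertranslation K) :
    (supermembrane K).bracket x y = supertranslationBracket x y :=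
  LInftySuperalgebra.twoTerm_bracket x y

theorem supermembrane_action (x : Supertranslation K) (r : ℝ) :
    (supermembrane K).action 2 x r = (0 : ℝ) :=
  LInftySuperalgebra.twoTerm_action x r

theorem supermembrane_topCochain (x : Fin 4 → Supertranslation K) :
    (supermembrane K).topCochain 2 x = membraneCochain x :=
  LInftySuperalgebra.twoTerm_topCochain x

theorem supermembrane_correspondsTo : (supermembrane K).CorrespondsTo 2
    (SuperRepresentation.trivial (Supertranslation K) ℝ) membraneCochain :=
  ⟨supermembrane_isTwoTerm K, LinearEquiv.refl ℝ (Supertranslation K), LinearEquiv.refl ℝ ℝ,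
    fun _ _ => Iff.rfl, fun _ _ => Iff.rfl, supermembrane_bracket K, supermembrane_action K,
    supermembrane_topCochain K⟩

/-! ### Non-exactness and the extension -/

theorem not_isTrivialCocycle_membraneCochain :
    ¬ IsTrivialCocycle (fun x y : Supertranslation K => supertranslationBracket x y)
      (fun _ _ => (0 : ℝ)) (membraneCochain (K := K)) := by
  rintro ⟨θ₀, θ₁, -, -, h⟩
  -- The spinors lie in different halves of `K⁴` along orthogonal basis vectors, so `Ψ·Φ = 0`. The
  -- commutator of `v` and `w` is block diagonal with blocks `∓2` times the off-diagonal matrix of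
  -- `w`; it sends `Φ` to `2` times the first basis vector of the lower half, so `β` takes the value
  -- `-2`.
  let Ψ : Spinor K := Sum.elim ![1, 0] 0
  let Φ : Spinor K := Sum.elim 0 ![0, 1]
  let v : Vec K := (0, ⟨1, star_one _⟩)
  let w : Vec K := (0, ⟨!![0, 1; 1, 0], by
    change star _ = _
    ext i j
    fin_cases i <;> fin_cases j <;> simp [Matrix.star_apply]⟩)
  have hd : spinorDot Ψ Φ = 0 := by
    refine Prod.ext ?_ (Subtype.ext ?_)
    · simp [spinorDot, Ψ, Φ, dotProduct]
    · ext i j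
      simp [spinorDot, Ψ, Φ, hermOuter, traceReversal, Matrix.trace, Matrix.vecMulVec_apply,
        Matrix.diagonal_apply]
  have hx (i : Fin 4) : (![(0, Ψ), (0, Φ), (v, 0), (w, 0)] : Fin 4 → Supertranslation K) i ∈
      SuperSpace.part (Supertranslation K) ((![1, 1, 0, 0] : Fin 4 → ZMod 2) i) := by
    fin_cases i
    · exact mem_part_one.2 rfl
    · exact mem_part_one.2 rfl
    · exact mem_part_zero.2 rfl
    · exact mem_part_zero.2 rfl
  have hbr (i j : Fin 4) (hij : i < j) : supertranslationBracket
      ((![(0, Ψ), (0, Φ), (v, 0), (w, 0)] : Fin 4 → Supertranslation K) i)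
      ((![(0, Ψ), (0, Φ), (v, 0), (w, 0)] : Fin 4 → Supertranslation K) j) = 0 := by
    rw [supertranslationBracket_apply]
    fin_cases i <;> fin_cases j <;>
      first
      | exact absurd hij (by decide)
      | simp [hd, spinorDot_zero_left, spinorDot_zero_right]
  have h' := h _ _ hx
  rw [coboundary_eq_zero_of_bracket_eq_zero _ _ _ _ _ hbr,
    coboundary_eq_zero_of_bracket_eq_zero _ _ _ _ _ hbr,
    isMembraneForm_membraneCochain.apply, ← membraneForm_apply, membraneForm_apply_sub] at h'
  simp [spinorPairing_apply, cliffordAction, Vec.toMatrix, Matrix.mulVec, dotProduct,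
    traceReversal, Matrix.trace, Matrix.one_apply, Ψ, Φ, v, w, re_one] at h'
  rw [← one_add_one_eq_two, map_add, re_one] at h'
  norm_num at h'

theorem supermembrane_not_isExact : ¬ (supermembrane K).IsExact 2 := by
  rintro ⟨-, -, h⟩
  apply not_isTrivialCocycle_membraneCochain K
  have h₁ : (supermembrane K).bracket =
      fun x y : Supertranslation K => supertranslationBracket x y :=
    funext fun x => funext fun y => supermembrane_bracket K x y
  have h₂ : (supermembrane K).action 2 = fun (_ : Supertranslation K) (_ : ℝ) => (0 : ℝ) :=
    funext fun x => funext fun y => supermembrane_action K x y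
  have h₃ : (supermembrane K).topCochain 2 = membraneCochain (K := K) :=
    MultilinearMap.ext (supermembrane_topCochain K)
  rw [h₁, h₂, h₃] at h
  exact h

/-- Both ends are themselves two-term algebras, one with zero degree-0 part and one with zero
degree-2 part. The inclusion and the projection are strict because `β` takes its values in the
kernel of the projection and the operations vanish on the image of the inclusion. -/
theorem supermembrane_isExtension :
    (supermembrane K).IsExtension 2 (Supertranslation K) ℝ := by
  refine ⟨LInftySuperalgebra.twoTerm (W₀ := PUnit) (W₂ := ℝ) 0 0 (isCochain_zero _)
      (isCochain_zero _) (fun _ _ _ => rfl) (fun _ _ _ => coboundary_zero _ _ _ _),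
    LInftySuperalgebra.twoTerm (W₂ := PUnit) (supertranslationCochain (K := K)) 0
      isCochain_supertranslationCochain (isCochain_zero _) supertranslationCochain_nilpotent
      (fun _ _ _ => coboundary_zero _ _ _ _),
    LInftySuperalgebra.twoTermHom (f₀ := 0) (f₂ := LinearMap.id)
      (fun _ _ _ => Submodule.zero_mem _) (fun _ _ h => h)
      (fun x => ?_) (fun x => ?_),
    LInftySuperalgebra.twoTermHom (f₀ := LinearMap.id) (f₂ := 0)
      (fun _ _ h => h) (fun _ _ _ => Submodule.zero_mem _) (fun x => rfl) (fun x => rfl),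
    ⟨?_, ?_, LinearEquiv.refl ℝ ℝ, fun _ _ => Iff.rfl⟩,
    ⟨?_, LinearEquiv.refl ℝ (Supertranslation K), fun _ _ => Iff.rfl, ?_⟩, ?_⟩
  · exact (MultilinearMap.map_zero _).symm
  · exact (MultilinearMap.map_zero _).symm
  · rintro (_ | _ | _ | q) hq
    · exact inferInstanceAs (Subsingleton PUnit)
    · exact inferInstanceAs (Subsingleton PUnit)
    · exact absurd rfl hq
    · exact inferInstanceAs (Subsingleton PUnit)
  · exact fun k => MultilinearMap.ext fun y => bracketCochainOp_zero_zero k y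
  · rintro (_ | _ | _ | q) hq
    · exact absurd rfl hq
    all_goals exact inferInstanceAs (Subsingleton PUnit)
  · exact fun x y => LInftySuperalgebra.twoTerm_bracket x y
  -- In degree 0 the sequence is `0 → T = T`, in degree 2 it is `ℝ = ℝ → 0`, and elsewhere all terms
  -- are zero.
  · rintro (_ | _ | _ | q)
    · exact ⟨fun _ _ _ => rfl, fun y => ⟨fun h => ⟨PUnit.unit, h.symm⟩, fun ⟨_, h⟩ => h.symm⟩,
        fun y => ⟨y, rfl⟩⟩
    · exact ⟨fun _ _ _ => rfl, fun y => ⟨fun _ => ⟨PUnit.unit, rfl⟩, fun _ => rfl⟩,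
        fun y => ⟨PUnit.unit, rfl⟩⟩
    · exact ⟨fun _ _ h => h, fun y => ⟨fun _ => ⟨y, rfl⟩, fun _ => rfl⟩,
        fun y => ⟨(0 : ℝ), rfl⟩⟩
    · exact ⟨fun _ _ _ => rfl, fun y => ⟨fun _ => ⟨PUnit.unit, rfl⟩, fun _ => rfl⟩,
        fun y => ⟨PUnit.unit, rfl⟩⟩

end Supermembrane

/-- Existence of the non-exact Lie 3-superalgebra extending the supertranslation algebra, in
spacetime dimensions 4, 5, 7 and 11 (for the reals, complexes, quaternions and octonions). -/
theorem mainTheorem9 :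
    (Module.finrank ℝ (Vec ℝ) = 4 ∧ Module.finrank ℝ (Vec ℂ) = 5 ∧
      Module.finrank ℝ (Vec ℍ[ℝ]) = 7 ∧ Module.finrank ℝ (Vec Octonion) = 11) ∧
    ∀ (K : Type) [NonAssocRing K] [StarRing K] [Module ℝ K] [IsScalarTower ℝ K K]
      [SMulCommClass ℝ K K] [StarModule ℝ K] [NormedDivisionAlgebra K],
      Module.finrank ℝ (Vec K) = Module.finrank ℝ K + 3 ∧
      ∃ β : MultilinearMap ℝ (fun _ : Fin 4 => Supertranslation K) ℝ,
        (∀ β', IsMembraneForm β' ↔ β' = β) ∧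
        IsCocycle (fun x y => LieSuperalgebra.bracket x y)
          (fun x r => (SuperRepresentation.trivial (Supertranslation K) ℝ).map x r) β 0 ∧
        ∃ L : LInftySuperalgebra.{0},
          L.IsLieSuperalgebra 3 ∧
          L.CorrespondsTo 2 (SuperRepresentation.trivial (Supertranslation K) ℝ) β ∧
          ¬ L.IsExact 2 ∧
          L.IsExtension 2 (Supertranslation K) ℝ := by
  refine ⟨finrank_vec_examples, fun K => ?_⟩
  intros
  exact ⟨finrank_vec, membraneCochain,
    fun β' => ⟨fun h => h.unique isMembraneForm_membraneCochain,
      fun h => h ▸ isMembraneForm_membraneCochain⟩,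
    isCocycle_membraneCochain, supermembrane K, supermembrane_isLieSuperalgebra K,
    supermembrane_correspondsTo K, supermembrane_not_isExact K, supermembrane_isExtension K⟩
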